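/- Let $N\ge 1$ and let $\mathbb B_N$ be the open unit ball of $\mathbb C^N$ with $\langle z,w\rangle=\sum_j z_j\overline{w_j}$. Let $H^2(\mathbb B_N)$ be the Hardy space of all holomorphic $f$ on $\mathbb B_N$ with $\sup_{0<r<1}\int_{S_N}|f(r\zeta)|^2\,d\sigma(\zeta)<\infty$, where $\sigma$ is the normalized surface measure on the unit sphere $S_N$; it is a Hilbert space with inner product $\langle f,g\rangle=\lim_{r\to1^-}\int_{S_N}f(r\zeta)\overline{g(r\zeta)}\,d\sigma(\zeta)$. For a matrix or vector $X$, let $\overline X$, $X^T$ and $X^*$ denote the entrywise conjugate, the transpose and the conjugate transpose. Let $a_1\in\mathbb C\setminus\{0\}$, $a_0\in\mathbb B_N$ (a column vector), let $A$ be a complex symmetric $N\times N$ matrix ($A^T=A$) and $U$ a unitary symmetric $N\times N$ matrix, and put $$\psi(z)=\frac{a_1}{(1-\langle Uz,\overline{a_0}\rangle)^N},\qquad \varphi(z)=\frac{a_0-AUz}{1-\langle Uz,\overline{a_0}\rangle}\qquad(z\in\mathbb B_N).$$ Assume that $\varphi$ maps $\mathbb B_N$ into $\mathbb B_N$. Then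 the weighted composition operator $W_{\psi,\varphi}f=\psi\cdot(f\circ\varphi)$ is a bounded operator on $H^2(\mathbb B_N)$, and it is normal if and only if $$\overline{UA}\,AU-\overline{Ua_0}\,a_0^TU=A\overline A-a_0a_0^*\quad\text{and}\quad \overline{UA}\,a_0-\overline{Ua_0}=A\overline{a_0}-a_0.$$ -/

import Mathlib

open MeasureTheory Metric Filter Topology
open scoped ComplexConjugate Pointwise

noncomputable section

namespace HardyBall

/-- `ℂ^N` with its Euclidean inner product; its unit ball is `ball 0 1`. -/
abbrev CSpace (N : ℕ) := EuclideanSpace ℂ (Fin N)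

/-- The normalized surface measure `σ` on the unit sphere of `ℂ^N`. -/
def sphereMeasure (N : ℕ) : Measure (sphere (0 : CSpace N) 1) :=
  ((volume : Measure (CSpace N)).toSphere Set.univ)⁻¹ • (volume : Measure (CSpace N)).toSphere

instance sphereMeasure_isProb (N : ℕ) [NeZero N] : IsProbabilityMeasure (sphereMeasure N) := by
  constructor
  have : (volume : Measure (CSpace N)).toSphere ≠ 0 := Measure.toSphere_ne_zero _
  rw [sphereMeasure, Measure.smul_apply, smul_eq_mul]
  exact ENNReal.inv_mul_cancel (by rwa [Ne, Measure.measure_univ_eq_zero]) (measure_ne_top _ _)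

/-- `ζ ↦ uζ` on the unit sphere, `|u| = 1` -/
def sphereRot {N : ℕ} (u : ℂ) (hu : ‖u‖ = 1) (ζ : sphere (0 : CSpace N) 1) :
    sphere (0 : CSpace N) 1 :=
  ⟨u • (ζ : CSpace N), by simp [norm_smul, hu]⟩

/-- `z ↦ uz` as a real-linear isometry of `ℂ^N`, `|u| = 1` -/
def rotIso {N : ℕ} (u : ℂ) (hu : ‖u‖ = 1) : CSpace N ≃ₗᵢ[ℝ] CSpace N :=
  { (LinearEquiv.smulOfNeZero ℂ (CSpace N) u
      (by rintro rfl; simp at hu)).restrictScalars ℝ with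
    norm_map' := fun x => by
      change ‖u • x‖ = ‖x‖
      rw [norm_smul, hu, one_mul] }

theorem sphereRot_measurePreserving {N : ℕ} (u : ℂ) (hu : ‖u‖ = 1) :
    MeasurePreserving (sphereRot (N := N) u hu) (sphereMeasure N) (sphereMeasure N) := by
  have hu0 : u ≠ 0 := by rintro rfl; simp at hu
  have hc : Continuous (sphereRot (N := N) u hu) := by
    unfold sphereRot; fun_prop
  let e := rotIso (N := N) u hu
  have h : MeasurePreserving (sphereRot (N := N) u hu)
      (volume : Measure (CSpace N)).toSphere (volume : Measure (CSpace N)).toSphere := by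
    refine ⟨hc.measurable, ?_⟩
    ext s hs
    rw [Measure.map_apply hc.measurable hs, Measure.toSphere_apply' _ (hc.measurable hs),
      Measure.toSphere_apply' _ hs]
    congr 1
    have hB := e.measurePreserving.measure_preimage_equiv (f := e.toMeasurableEquiv)
      (Set.Ioo (0 : ℝ) 1 • (Subtype.val '' s))
    rw [← hB]
    congr 1
    ext x
    simp only [Set.mem_smul, Set.mem_image, Set.mem_preimage]
    constructor
    · rintro ⟨r, hr, _, ⟨ζ, hζ, rfl⟩, rfl⟩
      refine ⟨r, hr, _, ⟨_, hζ, rfl⟩, ?_⟩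
      change r • (u • (ζ : CSpace N)) = u • (r • (ζ : CSpace N))
      exact smul_comm _ _ _
    · rintro ⟨r, hr, _, ⟨ζ, hζ, rfl⟩, hx⟩
      have hx' : r • (ζ : CSpace N) = u • x := hx
      refine ⟨r, hr, _, ⟨sphereRot u⁻¹ (by simp [hu]) ζ, ?_, rfl⟩, ?_⟩
      · have : sphereRot u hu (sphereRot u⁻¹ (by simp [hu]) ζ) = ζ := by
          ext1; simp [sphereRot, smul_smul, hu0]
        rwa [this]
      · change r • (u⁻¹ • (ζ : CSpace N)) = x
        rw [smul_comm, hx', smul_smul, inv_mul_cancel₀ hu0, one_smul]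
  exact h.smul_measure _

/-- The normalized arc length on the circle, parametrized by `(0, 2π]`. -/
def circleProb : Measure ℝ :=
  ENNReal.ofReal (2 * Real.pi)⁻¹ • volume.restrict (Set.Ioc 0 (2 * Real.pi))

instance circleProb_isProb : IsProbabilityMeasure circleProb := by
  constructor
  simp only [circleProb, Measure.smul_apply, Measure.restrict_apply MeasurableSet.univ,
    Set.univ_inter, Real.volume_Ioc, smul_eq_mul, sub_zero]
  rw [← ENNReal.ofReal_mul (by positivity), inv_mul_cancel₀ (by positivity), ENNReal.ofReal_one]

theorem norm_sq_le_circle {g : ℂ → ℂ} (hg : ∀ l : ℂ, ‖l‖ ≤ 1 → DifferentiableAt ℂ g l) :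
    ‖g 0‖ ^ 2 ≤ ∫ t, ‖g (circleMap 0 1 t)‖ ^ 2 ∂circleProb := by
  have hcm : ∀ t : ℝ, ‖circleMap 0 1 t‖ = 1 := by intro t; simp
  have hc : Continuous fun t : ℝ => g (circleMap 0 1 t) :=
    continuous_iff_continuousAt.2 fun t =>
      ContinuousAt.comp (f := fun t : ℝ => circleMap 0 1 t) (hg _ (hcm t).le).continuousAt
        (continuous_circleMap 0 1).continuousAt
  obtain ⟨C, hC⟩ : ∃ C, ∀ x ∈ closedBall (0 : ℂ) 1, ‖g x‖ ≤ C :=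
    (isCompact_closedBall _ _).exists_bound_of_continuousOn
      fun l hl => (hg l (by simpa using hl)).continuousAt.continuousWithinAt
  have hb : ∀ t, ‖g (circleMap 0 1 t)‖ ≤ C := fun t => hC _ (by simp)
  have hmean : ∫ t, g (circleMap 0 1 t) ∂circleProb = g 0 := by
    have := circleAverage_of_differentiable_on_off_countable (c := 0) (R := 1)
      (f := g) (s := ∅) Set.countable_empty
      (fun l hl => (hg l (by simpa using hl)).continuousAt.continuousWithinAt)
      (fun l hl => hg l (by simpa using ball_subset_closedBall hl.1))
    rw [← this, Real.circleAverage, intervalIntegral.integral_of_le (by positivity), circleProb,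
      integral_smul_measure, ENNReal.toReal_ofReal (by positivity)]
  have hi1 : Integrable (fun t => ‖g (circleMap 0 1 t)‖) circleProb :=
    Integrable.of_bound hc.norm.aestronglyMeasurable C (.of_forall fun t => by simpa using hb t)
  have hi2 : Integrable (fun t => ‖g (circleMap 0 1 t)‖ ^ 2) circleProb :=
    Integrable.of_bound (hc.norm.pow 2).aestronglyMeasurable (C ^ 2)
      (.of_forall fun t => by
        simpa using pow_le_pow_left₀ (norm_nonneg _) (hb t) 2)
  rw [← hmean]
  calc ‖∫ t, g (circleMap 0 1 t) ∂circleProb‖ ^ 2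
      ≤ (∫ t, ‖g (circleMap 0 1 t)‖ ∂circleProb) ^ 2 :=
        pow_le_pow_left₀ (norm_nonneg _) (norm_integral_le_integral_norm _) 2
    _ ≤ ∫ t, ‖g (circleMap 0 1 t)‖ ^ 2 ∂circleProb :=
        (convexOn_pow 2).map_integral_le (by fun_prop) isClosed_Ici
          (.of_forall fun t => norm_nonneg _) hi1 hi2

/-- `r ↦ ∫ |f(rζ)|² dσ(ζ)` -/
def sqMean {N : ℕ} (f : CSpace N → ℂ) (r : ℝ) : ℝ :=
  ∫ ζ, ‖f ((r : ℂ) • (ζ : CSpace N))‖ ^ 2 ∂(sphereMeasure N)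

theorem continuous_slice {N : ℕ} {f : CSpace N → ℂ} (hf : ContinuousOn f (ball 0 1))
    {c : ℂ} (hc : ‖c‖ < 1) :
    Continuous fun ζ : sphere (0 : CSpace N) 1 => f (c • (ζ : CSpace N)) := by
  refine hf.comp_continuous (by fun_prop) fun ζ => ?_
  simpa [norm_smul] using hc

theorem sqMean_mono {N : ℕ} [NeZero N] {f : CSpace N → ℂ}
    (hf : DifferentiableOn ℂ f (ball 0 1)) {r R : ℝ} (hr : 0 ≤ r) (hrR : r ≤ R) (hR : R < 1) :
    sqMean f r ≤ sqMean f R := by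
  rcases hrR.eq_or_lt with rfl | hlt
  · exact le_rfl
  have hR0 : 0 < R := hr.trans_lt hlt
  set s : ℝ := r / R with hs
  have hs0 : 0 ≤ s := by positivity
  have hs1 : s < 1 := (div_lt_one hR0).2 hlt
  have hRs : (R : ℂ) * s = r := by
    rw [← Complex.ofReal_mul, hs, mul_div_cancel₀ _ hR0.ne']
  let m : ℂ → ℂ := fun l => (l + s) / (1 + s * l)
  have hden : ∀ l : ℂ, ‖l‖ ≤ 1 → (1 + s * l : ℂ) ≠ 0 := by
    intro l hl h
    have h1 : ‖(s * l : ℂ)‖ = 1 := by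
      rw [show (s * l : ℂ) = -1 by linear_combination h]; simp
    rw [norm_mul, Complex.norm_real, Real.norm_of_nonneg hs0] at h1
    nlinarith [norm_nonneg l]
  have hsq : ∀ l : ℂ, ‖(1 + s * l : ℂ)‖ ^ 2 - ‖l + s‖ ^ 2 = (1 - s ^ 2) * (1 - ‖l‖ ^ 2) := by
    intro l
    simp only [← Complex.normSq_eq_norm_sq, Complex.normSq_apply]
    simp
    ring
  have hm_le : ∀ l : ℂ, ‖l‖ ≤ 1 → ‖m l‖ ≤ 1 := by
    intro l hl
    have h0 : 0 < ‖(1 + s * l : ℂ)‖ := norm_pos_iff.2 (hden l hl)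
    have : ‖l + s‖ ≤ ‖(1 + s * l : ℂ)‖ := by
      refine le_of_sq_le_sq ?_ h0.le |>.trans le_rfl
      have := hsq l
      have h2 : 0 ≤ (1 - s ^ 2) * (1 - ‖l‖ ^ 2) :=
        mul_nonneg (by nlinarith) (by nlinarith [norm_nonneg l])
      linarith
    simp only [m, norm_div]
    exact (div_le_one h0).2 this
  have hm_eq : ∀ l : ℂ, ‖l‖ = 1 → ‖m l‖ = 1 := by
    intro l hl
    have h0 : 0 < ‖(1 + s * l : ℂ)‖ := norm_pos_iff.2 (hden l hl.le)
    have h3 : ‖l + s‖ ^ 2 = ‖(1 + s * l : ℂ)‖ ^ 2 := by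
      have := hsq l
      rw [hl] at this
      linarith
    have := (pow_left_inj₀ (norm_nonneg _) (norm_nonneg _) two_ne_zero).1 h3
    simp only [m, norm_div, this]
    exact div_self h0.ne'
  have hcm : ∀ t : ℝ, ‖circleMap 0 1 t‖ = 1 := by intro t; simp
  have hmc : Continuous fun t : ℝ => m (circleMap 0 1 t) := by
    refine Continuous.div (by fun_prop) (by fun_prop) fun t => hden _ (hcm t).le
  let G : sphere (0 : CSpace N) 1 → ℝ → ℂ := fun ζ t =>
    f (((R : ℂ) * m (circleMap 0 1 t)) • (ζ : CSpace N))
  have hGc : Continuous (Function.uncurry G) := by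
    refine hf.continuousOn.comp_continuous (f := fun p : sphere (0 : CSpace N) 1 × ℝ =>
      ((R : ℂ) * m (circleMap 0 1 p.2)) • (p.1 : CSpace N)) ?_ fun p => ?_
    · exact (continuous_const.mul (hmc.comp continuous_snd)).smul
        (continuous_subtype_val.comp continuous_fst)
    · simpa [norm_smul, hm_eq _ (hcm p.2), abs_of_pos hR0] using hR
  obtain ⟨C, hC⟩ : ∃ C, ∀ x ∈ closedBall (0 : CSpace N) R, ‖f x‖ ≤ C :=
    (isCompact_closedBall _ _).exists_bound_of_continuousOn
      (hf.continuousOn.mono (closedBall_subset_ball hR))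
  have hGb : ∀ ζ t, ‖G ζ t‖ ≤ C := by
    intro ζ t
    apply hC
    simp [norm_smul, hm_eq _ (hcm t), abs_of_pos hR0]
  have hC0 : ∀ ζ t, ‖G ζ t‖ ^ 2 ≤ C ^ 2 := fun ζ t =>
    pow_le_pow_left₀ (norm_nonneg _) (hGb ζ t) 2
  have hjensen : ∀ ζ : sphere (0 : CSpace N) 1,
      ‖f ((r : ℂ) • (ζ : CSpace N))‖ ^ 2 ≤ ∫ t, ‖G ζ t‖ ^ 2 ∂circleProb := by
    intro ζ
    have := norm_sq_le_circle (g := fun l => f (((R : ℂ) * m l) • (ζ : CSpace N))) ?_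
    · simpa [m, hRs, G] using this
    · intro l hl'
      have hin : ((R : ℂ) * m l) • (ζ : CSpace N) ∈ ball (0 : CSpace N) 1 := by
        simp only [mem_ball_zero_iff, norm_smul, norm_mul, Complex.norm_real, Real.norm_eq_abs,
          abs_of_pos hR0, norm_eq_of_mem_sphere, mul_one]
        nlinarith [hm_le l hl', norm_nonneg (m l)]
      have h1 : DifferentiableAt ℂ f (((R : ℂ) * m l) • (ζ : CSpace N)) :=
        hf.differentiableAt (isOpen_ball.mem_nhds hin)
      have h2 : DifferentiableAt ℂ m l :=
        DifferentiableAt.div (by fun_prop) (by fun_prop) (hden l hl')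
      exact h1.comp l ((h2.const_mul _).smul_const _)
  have hint : Integrable (Function.uncurry fun ζ t => ‖G ζ t‖ ^ 2) ((sphereMeasure N).prod circleProb) :=
    Integrable.of_bound (hGc.norm.pow 2).aestronglyMeasurable (C ^ 2)
      (.of_forall fun p => by simpa [Function.uncurry_def] using hC0 p.1 p.2)
  calc sqMean f r ≤ ∫ ζ, ∫ t, ‖G ζ t‖ ^ 2 ∂circleProb ∂(sphereMeasure N) := by
        refine integral_mono ?_ hint.integral_prod_left hjensen
        refine ((continuous_slice hf.continuousOn (c := r) ?_).norm.pow 2).integrable_of_hasCompactSupport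
          (HasCompactSupport.of_compactSpace _)
        simpa [abs_of_nonneg hr] using hlt.trans hR
    _ = ∫ t, ∫ ζ, ‖G ζ t‖ ^ 2 ∂(sphereMeasure N) ∂circleProb := integral_integral_swap hint
    _ = ∫ t, sqMean f R ∂circleProb := by
        refine integral_congr_ae (.of_forall fun t => ?_)
        have hcont : Continuous fun ζ : sphere (0 : CSpace N) 1 =>
            ‖f ((R : ℂ) • (ζ : CSpace N))‖ ^ 2 :=
          (continuous_slice hf.continuousOn (by simpa [abs_of_pos hR0] using hR)).norm.pow 2
        have h := sphereRot_measurePreserving (N := N) _ (hm_eq _ (hcm t))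
        have h2 := integral_map (μ := sphereMeasure N) h.measurable.aemeasurable
          (f := fun ζ : sphere (0 : CSpace N) 1 => ‖f ((R : ℂ) • (ζ : CSpace N))‖ ^ 2)
          hcont.aestronglyMeasurable
        rw [h.map_eq] at h2
        simp only [sqMean, h2, G, sphereRot, smul_smul]
    _ = sqMean f R := by simp

theorem exists_point_bound {N : ℕ} [NeZero N] {R : ℝ} (hR : R < 1) :
    ∃ C : ℝ, 0 ≤ C ∧ ∀ f : CSpace N → ℂ, DifferentiableOn ℂ f (ball 0 1) →
      (∀ z ∉ ball (0 : CSpace N) 1, f z = 0) → ∀ K : ℝ,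
      (∀ r ∈ Set.Ioo (0 : ℝ) 1, sqMean f r ≤ K) →
      ∀ w : CSpace N, ‖w‖ ≤ R → ‖f w‖ ^ 2 ≤ C * K := by
  set T : ENNReal := (volume : Measure (CSpace N)).toSphere Set.univ with hT
  set V : ENNReal := Measure.volumeIoiPow (Module.finrank ℝ (CSpace N) - 1)
    (Set.Iio ⟨1, Set.mem_Ioi.2 one_pos⟩) with hV
  set B : ENNReal := (volume : Measure (CSpace N)) (ball 0 (1 - R)) with hB
  have hT0 : T ≠ 0 := by
    rw [hT, Ne, Measure.measure_univ_eq_zero]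
    exact Measure.toSphere_ne_zero _
  have hTtop : T ≠ ⊤ := measure_ne_top _ _
  have hVtop : V ≠ ⊤ := by
    rw [hV, Measure.volumeIoiPow_apply_Iio]
    exact ENNReal.ofReal_ne_top
  have hB0 : B ≠ 0 := (measure_ball_pos _ _ (by linarith)).ne'
  have hBtop : B ≠ ⊤ := measure_ball_lt_top.ne
  refine ⟨(B⁻¹ * (V * T)).toReal, ENNReal.toReal_nonneg, ?_⟩
  intro f hf hf0 K hK w hw
  have hfm : Measurable f := by
    classical
    have h1 : f = (ball (0 : CSpace N) 1).piecewise f (fun _ => 0) := by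
      ext z
      by_cases hz : z ∈ ball (0 : CSpace N) 1
      · rw [Set.piecewise_eq_of_mem _ _ _ hz]
      · rw [Set.piecewise_eq_of_notMem _ _ _ hz, hf0 z hz]
    rw [h1]
    exact hf.continuousOn.measurable_piecewise continuousOn_const measurableSet_ball
  set F : CSpace N → ENNReal := fun z => ENNReal.ofReal (‖f z‖ ^ 2) with hF
  have hFm : Measurable F := by fun_prop
  have hK0 : 0 ≤ K := (integral_nonneg fun ζ => by positivity).trans
    (hK (1 / 2) ⟨by norm_num, by norm_num⟩)
  -- the integral over the ball in polar coordinates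
  have hpolar : ∫⁻ z, F z ≤ V * T * ENNReal.ofReal K := by
    have h1 : ∫⁻ z, F z = ∫⁻ z : ({0}ᶜ : Set (CSpace N)), F z ∂(volume.comap Subtype.val) := by
      rw [lintegral_subtype_comap (measurableSet_singleton _).compl, restrict_compl_singleton]
    have h2 := (volume : Measure (CSpace N)).measurePreserving_homeomorphUnitSphereProd
    have h3 : ∫⁻ z : ({0}ᶜ : Set (CSpace N)), F z ∂(volume.comap Subtype.val) =
        ∫⁻ p : sphere (0 : CSpace N) 1 × Set.Ioi (0 : ℝ), F ((p.2 : ℝ) • (p.1 : CSpace N))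
          ∂((volume : Measure (CSpace N)).toSphere.prod
            (Measure.volumeIoiPow (Module.finrank ℝ (CSpace N) - 1))) := by
      rw [← h2.map_eq, lintegral_map]
      · refine lintegral_congr fun z => ?_
        congr 1
        have hz : ‖(z : CSpace N)‖ ≠ 0 := norm_ne_zero_iff.2 z.2
        simp [smul_smul, hz]
      · exact hFm.comp (by fun_prop)
      · exact h2.measurable
    have h5 : Measurable fun p : sphere (0 : CSpace N) 1 × Set.Ioi (0 : ℝ) =>
        F ((p.2 : ℝ) • (p.1 : CSpace N)) := hFm.comp (by fun_prop)
    rw [h1, h3, lintegral_prod_symm' _ h5]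
    calc _ ≤ ∫⁻ r : Set.Ioi (0 : ℝ), (Set.Iio (⟨1, Set.mem_Ioi.2 one_pos⟩ : Set.Ioi (0 : ℝ))).indicator
            (fun _ => T * ENNReal.ofReal K) r
            ∂(Measure.volumeIoiPow (Module.finrank ℝ (CSpace N) - 1)) := by
          refine lintegral_mono fun r => ?_
          by_cases hr : r ∈ Set.Iio (⟨1, Set.mem_Ioi.2 one_pos⟩ : Set.Ioi (0 : ℝ))
          · have hr1 : (r : ℝ) < 1 := hr
            have hr0 : (0 : ℝ) < r := r.2
            rw [Set.indicator_of_mem hr]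
            have h4 : (volume : Measure (CSpace N)).toSphere = T • sphereMeasure N := by
              rw [sphereMeasure, smul_smul, ENNReal.mul_inv_cancel hT0 hTtop, one_smul]
            rw [h4, lintegral_smul_measure, smul_eq_mul]
            gcongr
            have hc : Continuous fun ζ : sphere (0 : CSpace N) 1 =>
                ‖f (((r : ℝ) : ℂ) • (ζ : CSpace N))‖ ^ 2 := (continuous_slice hf.continuousOn (c := ((r : ℝ) : ℂ))
              (by simpa [abs_of_pos hr0] using hr1)).norm.pow 2
            calc ∫⁻ ζ : sphere (0 : CSpace N) 1, F ((r : ℝ) • (ζ : CSpace N)) ∂(sphereMeasure N)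
                = ENNReal.ofReal (sqMean f r) := by
                  rw [sqMean, ofReal_integral_eq_lintegral_ofReal
                    (hc.integrable_of_hasCompactSupport (HasCompactSupport.of_compactSpace _))
                    (.of_forall fun ζ => by positivity)]
                  refine lintegral_congr fun ζ => ?_
                  simp [F, Complex.coe_smul]
              _ ≤ ENNReal.ofReal K := ENNReal.ofReal_le_ofReal (hK r ⟨hr0, hr1⟩)
          · have hr1 : 1 ≤ (r : ℝ) := not_lt.1 hr
            rw [Set.indicator_of_notMem hr]
            refine le_of_eq ((lintegral_congr fun ζ => ?_).trans lintegral_zero)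
            have : f ((r : ℝ) • (ζ : CSpace N)) = 0 := by
              apply hf0
              simp only [mem_ball_zero_iff, norm_smul, norm_eq_of_mem_sphere, mul_one, not_lt,
                Real.norm_eq_abs]
              exact hr1.trans (le_abs_self _)
            simp [F, this]
      _ = V * T * ENNReal.ofReal K := by
          rw [lintegral_indicator measurableSet_Iio, setLIntegral_const]
          ring
  -- the sub-mean value property over a small ball
  have hsub : F w * B ≤ ∫⁻ z, F z := by
    have h1 : ∀ u ∈ ball (0 : CSpace N) (1 - R),
        F w ≤ ∫⁻ t, F (w + circleMap 0 1 t • u) ∂circleProb := by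
      intro u hu
      have hu' : ‖u‖ < 1 - R := by simpa using hu
      have hin : ∀ l : ℂ, ‖l‖ ≤ 1 → w + l • u ∈ ball (0 : CSpace N) 1 := by
        intro l hl
        rw [mem_ball_zero_iff]
        calc ‖w + l • u‖ ≤ ‖w‖ + ‖l‖ * ‖u‖ := (norm_add_le _ _).trans (by rw [norm_smul])
          _ ≤ ‖w‖ + 1 * ‖u‖ := by gcongr
          _ < 1 := by linarith
      have hd : ∀ l : ℂ, ‖l‖ ≤ 1 → DifferentiableAt ℂ (fun l : ℂ => f (w + l • u)) l := by
        intro l hl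
        have h1 : DifferentiableAt ℂ f (w + l • u) :=
          hf.differentiableAt (isOpen_ball.mem_nhds (hin l hl))
        exact h1.comp l (by fun_prop)
      have h2 := norm_sq_le_circle hd
      have hcont : Continuous fun t : ℝ => f (w + circleMap 0 1 t • u) :=
        hf.continuousOn.comp_continuous (by fun_prop) fun t => hin _ (by simp)
      obtain ⟨C, hC⟩ : ∃ C, ∀ x ∈ closedBall (0 : ℂ) 1, ‖f (w + x • u)‖ ≤ C :=
        (isCompact_closedBall _ _).exists_bound_of_continuousOn
          fun l hl => (hd l (by simpa using hl)).continuousAt.continuousWithinAt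
      have hi : Integrable (fun t => ‖f (w + circleMap 0 1 t • u)‖ ^ 2) circleProb :=
        Integrable.of_bound (hcont.norm.pow 2).aestronglyMeasurable (C ^ 2)
          (.of_forall fun t => by
            simpa using pow_le_pow_left₀ (norm_nonneg _) (hC (circleMap 0 1 t) (by simp)) 2)
      simp only [F]
      rw [← ofReal_integral_eq_lintegral_ofReal hi (.of_forall fun t => by positivity)]
      exact ENNReal.ofReal_le_ofReal (by simpa using h2)
    have hjm : Measurable fun p : CSpace N × ℝ => F (w + circleMap 0 1 p.2 • p.1) :=
      hFm.comp (Continuous.measurable (by fun_prop))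
    calc F w * B = ∫⁻ u in ball (0 : CSpace N) (1 - R), F w := (setLIntegral_const _ _).symm
      _ ≤ ∫⁻ u in ball (0 : CSpace N) (1 - R), ∫⁻ t, F (w + circleMap 0 1 t • u) ∂circleProb :=
          setLIntegral_mono' measurableSet_ball h1
      _ ≤ ∫⁻ u, ∫⁻ t, F (w + circleMap 0 1 t • u) ∂circleProb := setLIntegral_le_lintegral _ _
      _ = ∫⁻ t, (∫⁻ u : CSpace N, F (w + circleMap 0 1 t • u)) ∂circleProb :=
          lintegral_lintegral_swap hjm.aemeasurable
      _ = ∫⁻ t, (∫⁻ z : CSpace N, F z) ∂circleProb := by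
          refine lintegral_congr fun t => ?_
          have h2 := (rotIso (N := N) (circleMap 0 1 t) (by simp)).measurePreserving
          have h3 := h2.lintegral_comp (f := fun z => F (w + z)) (by fun_prop)
          exact h3.trans (lintegral_add_left_eq_self F w)
      _ = ∫⁻ z, F z := by simp
  have hfin : F w ≤ B⁻¹ * (V * T) * ENNReal.ofReal K := by
    rw [mul_assoc, ← ENNReal.div_eq_inv_mul, ENNReal.le_div_iff_mul_le (.inl hB0) (.inl hBtop)]
    exact hsub.trans hpolar
  have hfin2 := ENNReal.toReal_mono (by finiteness) hfin
  rwa [ENNReal.toReal_mul, ENNReal.toReal_ofReal hK0, ENNReal.toReal_ofReal (by positivity)] at hfin2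

theorem differentiableOn_of_uniform_limit {N : ℕ} {u : ℕ → CSpace N → ℂ} {f : CSpace N → ℂ}
    (hu : ∀ n, DifferentiableOn ℂ (u n) (ball 0 1))
    (hlim : ∀ z ∈ ball (0 : CSpace N) 1, Tendsto (fun n => u n z) atTop (𝓝 (f z)))
    (hc : ∀ R < (1 : ℝ), UniformCauchySeqOn u atTop (closedBall 0 R)) :
    DifferentiableOn ℂ f (ball 0 1) := by
  have key : ∀ R < (1 : ℝ),
      UniformCauchySeqOn (fun n => fderiv ℂ (u n)) atTop (ball (0 : CSpace N) R) := by
    intro R hR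
    set R' := (1 + R) / 2 with hR'
    set δ := R' - R with hδ
    have hδ0 : 0 < δ := by rw [hδ, hR']; linarith
    have hR'1 : R' < 1 := by rw [hR']; linarith
    rw [Metric.uniformCauchySeqOn_iff]
    intro ε hε
    obtain ⟨M, hM⟩ := (Metric.uniformCauchySeqOn_iff.1 (hc R' hR'1)) (ε * δ / 4) (by positivity)
    refine ⟨M, fun m hm n hn z hz => ?_⟩
    have hz' : ‖z‖ < R := by simpa using hz
    have hsub : ball z δ ⊆ closedBall (0 : CSpace N) R' := by
      intro y hy
      have : ‖y - z‖ < δ := by simpa [dist_eq_norm] using hy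
      have h2 : ‖y‖ ≤ ‖y - z‖ + ‖z‖ := by simpa using norm_add_le (y - z) z
      simp only [mem_closedBall_zero_iff]
      linarith
    have hz1 : z ∈ ball (0 : CSpace N) 1 := by simp; linarith
    have hat : ∀ k, DifferentiableAt ℂ (u k) z := fun k =>
      (hu k).differentiableAt (isOpen_ball.mem_nhds hz1)
    have hd : DifferentiableOn ℂ (u m - u n) (ball z δ) :=
      ((hu m).sub (hu n)).mono (hsub.trans (closedBall_subset_ball hR'1))
    have hmaps : Set.MapsTo (u m - u n) (ball z δ)
        (closedBall ((u m - u n) z) (ε * δ / 2)) := by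
      intro y hy
      have h1 := hM m hm n hn y (hsub hy)
      have h2 := hM m hm n hn z (hsub (mem_ball_self hδ0))
      rw [dist_eq_norm] at h1 h2
      rw [mem_closedBall, dist_eq_norm]
      calc ‖(u m - u n) y - (u m - u n) z‖ ≤ ‖u m y - u n y‖ + ‖u m z - u n z‖ := norm_sub_le _ _
        _ ≤ ε * δ / 2 := by linarith
    have h3 := Complex.norm_fderiv_le_div_of_mapsTo_ball hd hmaps hδ0
    rw [fderiv_sub (hat m) (hat n)] at h3
    rw [dist_eq_norm]
    refine h3.trans_lt ?_
    rw [div_lt_iff₀ hδ0]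
    nlinarith
  intro z hz
  have hz' : ‖z‖ < 1 := by simpa using hz
  obtain ⟨R, hzR, hR⟩ := exists_between hz'
  have hzb : z ∈ ball (0 : CSpace N) R := by simpa using hzR
  have hlim' : ∀ y ∈ ball (0 : CSpace N) R,
      Tendsto (fun n => fderiv ℂ (u n) y) atTop (𝓝 (limUnder atTop fun n => fderiv ℂ (u n) y)) :=
    fun y hy => ((key R hR).cauchySeq hy).tendsto_limUnder
  have hunif := (key R hR).tendstoUniformlyOn_of_tendsto hlim'
  have h := hasFDerivAt_of_tendstoUniformlyOn (f := u) isOpen_ball hunif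
    (fun n y hy => ((hu n).differentiableAt
      (isOpen_ball.mem_nhds (ball_subset_ball hR.le hy))).hasFDerivAt)
    (fun y hy => hlim y (ball_subset_ball hR.le hy)) hzb
  exact h.differentiableAt.differentiableWithinAt

theorem sqMean_smul {N : ℕ} (c : ℂ) (f : CSpace N → ℂ) (r : ℝ) :
    sqMean (c • f) r = ‖c‖ ^ 2 * sqMean f r := by
  simp only [sqMean, Pi.smul_apply, norm_smul, mul_pow, integral_const_mul]

section Space

variable {N : ℕ} [NeZero N]

theorem integrable_slice {g : CSpace N → ℂ} (hg : ContinuousOn g (ball 0 1)) {r : ℝ}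
    (hr : r ∈ Set.Ioo (0 : ℝ) 1) :
    Integrable (fun ζ : sphere (0 : CSpace N) 1 => ‖g ((r : ℂ) • (ζ : CSpace N))‖ ^ 2) (sphereMeasure N) :=
  ((continuous_slice hg (c := (r : ℂ)) (by simpa [abs_of_pos hr.1] using hr.2)).norm.pow 2
    ).integrable_of_hasCompactSupport (HasCompactSupport.of_compactSpace _)

theorem sqMean_add_le {f g : CSpace N → ℂ} (hf : ContinuousOn f (ball 0 1))
    (hg : ContinuousOn g (ball 0 1)) {r : ℝ} (hr : r ∈ Set.Ioo (0 : ℝ) 1) :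
    sqMean (f + g) r ≤ 2 * sqMean f r + 2 * sqMean g r := by
  have h1 := integrable_slice hf hr
  have h2 := integrable_slice hg hr
  have h3 := integrable_slice (hf.add hg) hr
  simp only [sqMean]
  rw [← integral_const_mul, ← integral_const_mul, ← integral_add (h1.const_mul 2) (h2.const_mul 2)]
  refine integral_mono h3 ((h1.const_mul 2).add (h2.const_mul 2)) fun ζ => ?_
  simp only [Pi.add_apply]
  have := norm_add_le (f ((r : ℂ) • (ζ : CSpace N))) (g ((r : ℂ) • (ζ : CSpace N)))
  nlinarith [sq_nonneg (‖f ((r : ℂ) • (ζ : CSpace N))‖ - ‖g ((r : ℂ) • (ζ : CSpace N))‖),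
    norm_nonneg (f ((r : ℂ) • (ζ : CSpace N)) + g ((r : ℂ) • (ζ : CSpace N)))]

/-- The functions of the Hardy space `H²` of the unit ball: holomorphic on the ball, with
`sup_{0<r<1} ∫ |f(rζ)|² dσ(ζ) < ∞`. A function on the ball is represented by its extension by zero
to all of `ℂ^N`. -/
def hardySubmodule (N : ℕ) [NeZero N] : Submodule ℂ (CSpace N → ℂ) where
  carrier := {f | DifferentiableOn ℂ f (ball 0 1) ∧ (∀ z ∉ ball (0 : CSpace N) 1, f z = 0) ∧
    BddAbove (sqMean f '' Set.Ioo 0 1)}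
  zero_mem' := by
    refine ⟨differentiableOn_const 0, fun _ _ => rfl, 0, ?_⟩
    rintro _ ⟨r, -, rfl⟩
    simp [sqMean]
  add_mem' := by
    rintro f g ⟨hf, hf0, C, hC⟩ ⟨hg, hg0, D, hD⟩
    refine ⟨hf.add hg, fun z hz => by simp [hf0 z hz, hg0 z hz], 2 * C + 2 * D, ?_⟩
    rintro _ ⟨r, hr, rfl⟩
    have h1 := hC ⟨r, hr, rfl⟩
    have h2 := hD ⟨r, hr, rfl⟩
    have := sqMean_add_le hf.continuousOn hg.continuousOn hr
    linarith
  smul_mem' := by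
    rintro c f ⟨hf, hf0, C, hC⟩
    refine ⟨hf.const_smul c, fun z hz => by simp [hf0 z hz], ‖c‖ ^ 2 * C, ?_⟩
    rintro _ ⟨r, hr, rfl⟩
    rw [sqMean_smul]
    exact mul_le_mul_of_nonneg_left (hC ⟨r, hr, rfl⟩) (by positivity)

/-- The Hardy space `H²` of the unit ball of `ℂ^N`. -/
def HardySpace (N : ℕ) [NeZero N] : Type := hardySubmodule N

namespace HardySpace

instance : AddCommGroup (HardySpace N) := inferInstanceAs (AddCommGroup (hardySubmodule N))

instance : Module ℂ (HardySpace N) := inferInstanceAs (Module ℂ (hardySubmodule N))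

instance : FunLike (HardySpace N) (CSpace N) ℂ where
  coe f := f.1
  coe_injective := Subtype.val_injective

theorem coe_add (f g : HardySpace N) : ⇑(f + g) = ⇑f + ⇑g := rfl

theorem coe_sub (f g : HardySpace N) : ⇑(f - g) = ⇑f - ⇑g := rfl

theorem coe_smul (c : ℂ) (f : HardySpace N) : ⇑(c • f) = c • ⇑f := rfl

theorem coe_zero : ⇑(0 : HardySpace N) = 0 := rfl

theorem differentiableOn (f : HardySpace N) : DifferentiableOn ℂ f (ball 0 1) := f.2.1

theorem eq_zero_of_notMem (f : HardySpace N) {z : CSpace N} (hz : z ∉ ball (0 : CSpace N) 1) :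
    f z = 0 := f.2.2.1 z hz

theorem bddAbove (f : HardySpace N) : BddAbove (sqMean f '' Set.Ioo 0 1) := f.2.2.2

/-- `∫ conj f(rζ) g(rζ) dσ(ζ)` -/
def pairMean (f g : HardySpace N) (r : ℝ) : ℂ :=
  ∫ ζ, conj (f ((r : ℂ) • (ζ : CSpace N))) * g ((r : ℂ) • (ζ : CSpace N)) ∂(sphereMeasure N)

/-- The inner product `⟨g, f⟩ = lim_{r → 1⁻} ∫ g(rζ) conj f(rζ) dσ(ζ)`, conjugate-linear in the
first argument of `inner` as usual in Mathlib. -/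
instance : Inner ℂ (HardySpace N) where
  inner f g := limUnder (𝓝[<] (1 : ℝ)) (pairMean f g)

theorem tendsto_sqMean (f : HardySpace N) :
    Tendsto (sqMean f) (𝓝[<] (1 : ℝ)) (𝓝 (sSup (sqMean f '' Set.Ioo 0 1))) :=
  MonotoneOn.tendsto_nhdsWithin_Ioo_left (by simp)
    (fun _ hr _ hs hrs => sqMean_mono f.differentiableOn hr.1.le hrs hs.2) f.bddAbove

theorem eventually_mem : ∀ᶠ r in 𝓝[<] (1 : ℝ), r ∈ Set.Ioo (0 : ℝ) 1 :=
  Ioo_mem_nhdsLT one_pos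

theorem integrable_pair (f g : HardySpace N) {r : ℝ} (hr : r ∈ Set.Ioo (0 : ℝ) 1) :
    Integrable (fun ζ : sphere (0 : CSpace N) 1 => conj (f ((r : ℂ) • (ζ : CSpace N))) * g ((r : ℂ) • (ζ : CSpace N)))
      (sphereMeasure N) := by
  have h : ‖(r : ℂ)‖ < 1 := by simpa [abs_of_pos hr.1] using hr.2
  exact ((Complex.continuous_conj.comp (continuous_slice f.differentiableOn.continuousOn h)).mul
    (continuous_slice g.differentiableOn.continuousOn h)).integrable_of_hasCompactSupport
      (HasCompactSupport.of_compactSpace _)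

theorem pairMean_self (f : HardySpace N) (r : ℝ) : pairMean f f r = (sqMean f r : ℂ) := by
  simp only [pairMean, sqMean, Complex.conj_mul']
  exact_mod_cast integral_ofReal (𝕜 := ℂ)

theorem pairMean_eq (f g : HardySpace N) {r : ℝ} (hr : r ∈ Set.Ioo (0 : ℝ) 1) :
    pairMean f g r = ((sqMean ⇑(f + g) r : ℂ) - sqMean ⇑(f - g) r) / 4 +
      Complex.I * ((sqMean ⇑(f - Complex.I • g) r : ℂ) - sqMean ⇑(f + Complex.I • g) r) / 4 := by
  have hi := fun h : HardySpace N => integrable_pair h h hr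
  simp only [← pairMean_self, pairMean]
  rw [← integral_sub (hi _) (hi _), ← integral_sub (hi _) (hi _), ← integral_const_mul,
    ← integral_div, ← integral_div, ← integral_add]
  · refine integral_congr_ae (.of_forall fun ζ => ?_)
    simp only [coe_add, coe_sub, coe_smul, Pi.add_apply, Pi.sub_apply, Pi.smul_apply, smul_eq_mul,
      map_add, map_sub, map_mul, Complex.conj_I]
    linear_combination ((1 / 2 : ℂ) * conj (f ((r : ℂ) • (ζ : CSpace N))) *
      g ((r : ℂ) • (ζ : CSpace N)) - (1 / 2 : ℂ) * f ((r : ℂ) • (ζ : CSpace N)) *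
      conj (g ((r : ℂ) • (ζ : CSpace N)))) * Complex.I_sq
  · exact ((hi _).sub (hi _)).div_const _
  · exact (((hi _).sub (hi _)).const_mul _).div_const _

theorem tendsto_pairMean (f g : HardySpace N) :
    Tendsto (pairMean f g) (𝓝[<] (1 : ℝ)) (𝓝 (inner ℂ f g)) := by
  refine tendsto_nhds_limUnder ?_
  have h := fun k : HardySpace N =>
    (Complex.continuous_ofReal.tendsto _).comp (tendsto_sqMean k)
  refine ⟨_, Tendsto.congr' ?_ ((((h (f + g)).sub (h (f - g))).div_const 4).add
    ((((h (f - Complex.I • g)).sub (h (f + Complex.I • g))).const_mul Complex.I).div_const 4))⟩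
  filter_upwards [eventually_mem] with r hr
  rw [pairMean_eq f g hr]
  rfl

theorem inner_self_eq (f : HardySpace N) :
    inner ℂ f f = ((sSup (sqMean f '' Set.Ioo 0 1) : ℝ) : ℂ) := by
  refine tendsto_nhds_unique (tendsto_pairMean f f) ?_
  refine ((Complex.continuous_ofReal.tendsto _).comp (tendsto_sqMean f)).congr fun r => ?_
  exact (pairMean_self f r).symm

theorem sqMean_le_sSup (f : HardySpace N) {r : ℝ} (hr : r ∈ Set.Ioo (0 : ℝ) 1) :
    sqMean f r ≤ sSup (sqMean f '' Set.Ioo 0 1) := le_csSup f.bddAbove ⟨r, hr, rfl⟩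

instance instCore : InnerProductSpace.Core ℂ (HardySpace N) where
  conj_inner_symm f g := by
    refine tendsto_nhds_unique
      (((Complex.continuous_conj.tendsto _).comp (tendsto_pairMean g f)).congr fun r => ?_)
      (tendsto_pairMean f g)
    simp only [Function.comp_apply, pairMean, ← integral_conj]
    simp [mul_comm]
  re_inner_nonneg f := by
    rw [inner_self_eq]
    simp only [RCLike.re_eq_complex_re, Complex.ofReal_re]
    exact (integral_nonneg fun ζ => by positivity).trans
      (f.sqMean_le_sSup (r := 1 / 2) ⟨by norm_num, by norm_num⟩)
  add_left f g h := by
    refine tendsto_nhds_unique (tendsto_pairMean (f + g) h)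
      (((tendsto_pairMean f h).add (tendsto_pairMean g h)).congr' ?_)
    filter_upwards [eventually_mem] with r hr
    simp only [pairMean]
    rw [← integral_add (integrable_pair f h hr) (integrable_pair g h hr)]
    simp [coe_add, add_mul]
  smul_left f g c := by
    refine tendsto_nhds_unique (tendsto_pairMean (c • f) g)
      (((tendsto_pairMean f g).const_mul (conj c)).congr fun r => ?_)
    simp only [pairMean]
    rw [← integral_const_mul]
    simp [coe_smul, mul_assoc]
  definite f hf := by
    rw [inner_self_eq, Complex.ofReal_eq_zero] at hf
    refine DFunLike.coe_injective (funext fun z => ?_)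
    by_cases hz : z ∈ ball (0 : CSpace N) 1
    · have hz' : ‖z‖ < 1 := by simpa using hz
      obtain ⟨C, -, hC⟩ := exists_point_bound (N := N) hz'
      have h := hC f f.differentiableOn (fun w hw => f.eq_zero_of_notMem hw) 0
        (fun r hr => (f.sqMean_le_sSup hr).trans hf.le) z le_rfl
      have : ‖f z‖ ^ 2 = 0 := le_antisymm (by simpa using h) (by positivity)
      exact norm_eq_zero.1 (pow_eq_zero_iff two_ne_zero |>.1 this)
    · exact f.eq_zero_of_notMem hz

instance : NormedAddCommGroup (HardySpace N) :=
  InnerProductSpace.Core.toNormedAddCommGroup (𝕜 := ℂ)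

instance : InnerProductSpace ℂ (HardySpace N) :=
  InnerProductSpace.ofCore instCore.toCore

theorem norm_sq_eq (f : HardySpace N) : ‖f‖ ^ 2 = sSup (sqMean f '' Set.Ioo 0 1) := by
  rw [InnerProductSpace.norm_sq_eq_re_inner (𝕜 := ℂ), inner_self_eq]
  simp

instance : CompleteSpace (HardySpace N) := by
  refine Metric.complete_of_cauchySeq_tendsto fun u hu => ?_
  have hpt : ∀ R < (1 : ℝ), ∃ C : ℝ, 0 ≤ C ∧ ∀ f : HardySpace N, ∀ w : CSpace N, ‖w‖ ≤ R →
      ‖f w‖ ^ 2 ≤ C * ‖f‖ ^ 2 := by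
    intro R hR
    obtain ⟨C, hC0, hC⟩ := exists_point_bound (N := N) hR
    exact ⟨C, hC0, fun f w hw => hC f f.differentiableOn (fun w hw => f.eq_zero_of_notMem hw) _
      (fun r hr => (f.sqMean_le_sSup hr).trans f.norm_sq_eq.ge) w hw⟩
  have hunif : ∀ R < (1 : ℝ), UniformCauchySeqOn (fun n => ⇑(u n)) atTop
      (closedBall (0 : CSpace N) R) := by
    intro R hR
    obtain ⟨C, hC0, hC⟩ := hpt R hR
    rw [Metric.uniformCauchySeqOn_iff]
    intro ε hε
    obtain ⟨M, hM⟩ := Metric.cauchySeq_iff.1 hu (ε / (C + 1)) (by positivity)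
    refine ⟨M, fun m hm n hn z hz => ?_⟩
    have h1 := hC (u m - u n) z (by simpa using hz)
    have h2 := hM m hm n hn
    rw [dist_eq_norm, lt_div_iff₀ (by positivity)] at h2
    rw [dist_eq_norm]
    have h3 : ‖u m z - u n z‖ ^ 2 ≤ C * ‖u m - u n‖ ^ 2 := h1
    refine lt_of_pow_lt_pow_left₀ 2 hε.le ?_
    have h4 : (‖u m - u n‖ * (C + 1)) ^ 2 < ε ^ 2 :=
      pow_lt_pow_left₀ h2 (by positivity) two_ne_zero
    refine (h3.trans ?_).trans_lt h4
    nlinarith [sq_nonneg ‖u m - u n‖, mul_nonneg hC0 (sq_nonneg ‖u m - u n‖),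
      mul_nonneg (mul_nonneg hC0 hC0) (sq_nonneg ‖u m - u n‖)]
  have hlim : ∀ z : CSpace N, ∃ a : ℂ, Tendsto (fun n => u n z) atTop (𝓝 a) := by
    intro z
    by_cases hz : z ∈ ball (0 : CSpace N) 1
    · exact cauchySeq_tendsto_of_complete
        ((hunif ‖z‖ (by simpa using hz)).cauchySeq (x := z) (by simp))
    · exact ⟨0, by simp [eq_zero_of_notMem _ hz]⟩
  choose f hf using hlim
  have hfd : DifferentiableOn ℂ f (ball 0 1) :=
    differentiableOn_of_uniform_limit (fun n => (u n).differentiableOn) (fun z _ => hf z) hunif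
  have hf0 : ∀ z ∉ ball (0 : CSpace N) 1, f z = 0 := fun z hz =>
    tendsto_nhds_unique (hf z) (by simp [eq_zero_of_notMem _ hz])
  have hest : ∀ ε > 0, ∃ M, ∀ n ≥ M, ∀ r ∈ Set.Ioo (0 : ℝ) 1, sqMean (⇑(u n) - f) r ≤ ε ^ 2 := by
    intro ε hε
    obtain ⟨M, hM⟩ := Metric.cauchySeq_iff.1 hu ε hε
    refine ⟨M, fun n hn r hr => ?_⟩
    obtain ⟨C, hC0, hC⟩ := hpt r hr.2
    have hb : ∀ m ≥ M, ‖u n - u m‖ ^ 2 ≤ ε ^ 2 := by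
      intro m hm
      have := hM n hn m hm
      rw [dist_eq_norm] at this
      exact pow_le_pow_left₀ (norm_nonneg _) this.le 2
    have hin : ∀ ζ : sphere (0 : CSpace N) 1, ‖(r : ℂ) • (ζ : CSpace N)‖ ≤ r := by
      intro ζ
      simp [norm_smul, abs_of_pos hr.1]
    have ht : Tendsto (fun m => sqMean ⇑(u n - u m) r) atTop (𝓝 (sqMean (⇑(u n) - f) r)) := by
      refine tendsto_integral_filter_of_dominated_convergence (fun _ => C * ε ^ 2) ?_ ?_
        (integrable_const _) ?_
      · exact .of_forall fun m =>
          (integrable_slice (u n - u m).differentiableOn.continuousOn hr).aestronglyMeasurable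
      · filter_upwards [eventually_ge_atTop M] with m hm
        refine .of_forall fun ζ => ?_
        rw [Real.norm_of_nonneg (by positivity)]
        exact (hC (u n - u m) _ (hin ζ)).trans (mul_le_mul_of_nonneg_left (hb m hm) hC0)
      · refine .of_forall fun ζ => ?_
        exact ((tendsto_const_nhds.sub (hf _)).norm.pow 2)
    refine le_of_tendsto ht ?_
    filter_upwards [eventually_ge_atTop M] with m hm
    exact ((sqMean_le_sSup _ hr).trans (norm_sq_eq _).ge).trans (hb m hm)
  have hmem : f ∈ hardySubmodule N := by
    obtain ⟨M, hM⟩ := hest 1 one_pos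
    have h1 : ⇑(u M) - f ∈ hardySubmodule N := by
      refine ⟨(u M).differentiableOn.sub hfd,
        fun z hz => by simp [eq_zero_of_notMem _ hz, hf0 z hz], 1 ^ 2, ?_⟩
      rintro _ ⟨r, hr, rfl⟩
      exact hM M le_rfl r hr
    have h2 := (hardySubmodule N).sub_mem (u M).2 h1
    have h3 : (u M).1 - (⇑(u M) - f) = f := sub_sub_cancel _ _
    rwa [h3] at h2
  let F : HardySpace N := ⟨f, hmem⟩
  refine ⟨F, Metric.tendsto_atTop.2 fun ε hε => ?_⟩
  obtain ⟨M, hM⟩ := hest (ε / 2) (by positivity)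
  refine ⟨M, fun n hn => ?_⟩
  have h1 : ‖u n - F‖ ^ 2 ≤ (ε / 2) ^ 2 := by
    rw [norm_sq_eq]
    refine csSup_le (Set.Nonempty.image _ (by simp)) ?_
    rintro _ ⟨r, hr, rfl⟩
    exact hM n hn r hr
  rw [dist_eq_norm]
  have := (pow_le_pow_iff_left₀ (norm_nonneg _) (by positivity) two_ne_zero).1 h1
  linarith

end HardySpace

end Space

/-- The coordinatewise complex conjugate of a vector. -/
def conjVec {N : ℕ} (a : CSpace N) : CSpace N := WithLp.toLp 2 fun j => conj (a j)

/-- `ψ(z) = a₁ / (1 - ⟨Uz, conj a₀⟩)^N`, where `⟨z, w⟩ = ∑ z_j conj w_j` is `inner ℂ w z`. -/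
def weight {N : ℕ} (a₁ : ℂ) (a₀ : CSpace N) (U : Matrix (Fin N) (Fin N) ℂ) (z : CSpace N) : ℂ :=
  a₁ / (1 - inner ℂ (conjVec a₀) (Matrix.toEuclideanLin U z)) ^ N

/-- `φ(z) = (a₀ - AUz) / (1 - ⟨Uz, conj a₀⟩)` -/
def symbol {N : ℕ} (a₀ : CSpace N) (A U : Matrix (Fin N) (Fin N) ℂ) (z : CSpace N) : CSpace N :=
  (1 - inner ℂ (conjVec a₀) (Matrix.toEuclideanLin U z))⁻¹ •
    (a₀ - Matrix.toEuclideanLin (A * U) z)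

/-- The bounded operator `W` on `H²` is the weighted composition operator
`W_{ψ,φ} f = ψ · (f ∘ φ)` (an identity of functions on the ball). -/
def IsWeightedComposition {N : ℕ} [NeZero N] (ψ : CSpace N → ℂ) (φ : CSpace N → CSpace N)
    (W : HardySpace N →L[ℂ] HardySpace N) : Prop :=
  ∀ f : HardySpace N, ∀ z ∈ ball (0 : CSpace N) 1, W f z = ψ z * f (φ z)

end HardyBall

end

open HardyBall

/-! The Szegő kernel k_w(z) = (1 - ⟨z,w⟩)^{-N} reproduces the values of functions in H², so the k_w
span a dense subspace, and both boundedness and normality become statements about explicit kernels.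
Write Lz = ⟨Uz, conj a₀⟩, T = AU and Q(z,w) = (1 - Lz) conj(1 - Lw) - ⟨a₀ - Tz, a₀ - Tw⟩
(`fracForm`).

Boundedness. The adjoint of W must send k_w to conj ψ(w) · k_{φ(w)}, and these vectors have kernel
ψ(z) conj ψ(w) k(φ(z), φ(w)) = |a₁|² / Q(z,w)^N. A self-map of the ball makes Q nonnegative on the
cone ‖z‖ ≤ |c| after homogenization, so an S-lemma gives t > 0 with Q(z,w) - t(1 - ⟨z,w⟩) positive
semidefinite (`exists_pos_mul_le_of_mapsTo`, `posSemidef_fracForm_sub`). Schur products transfer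
this to the inverse N-th powers (`posSemidef_inv_pow_sub_inv_pow`), which is the norm bound ‖W‖² ≤
|a₁|² / t^N.

Normality. The kernel of WW* is |a₁|² / Q^N. Since 1 - Lz - ⟨a₀ - Tz, w⟩ is affine in z, W also
sends k_w to a multiple of a kernel function, located at a second linear fractional map of w;
symmetry of A makes that map preserve the ball. Hence W*W has kernel |a₁|² / Q'^N, where Q' is built
from ⟨·, a₀⟩, A* and conj a₀. Normality is Q^N = Q'^N; a connectedness argument removes the power
(`fracForm_eq_of_pow_eq`), and comparing coefficients of Q = Q' gives the two matrix identities
(`fracForm_eq_iff`). -/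

noncomputable section

namespace HardyBall

/-! ### Moments of the surface measure and unitary invariance. -/

section

theorem integral_polar {N : ℕ} [NeZero N] {F : CSpace N → ℝ} {g : sphere (0 : CSpace N) 1 → ℝ}
    {h : ℝ → ℝ} (hF : ∀ (ζ : sphere (0 : CSpace N) 1) (r : ℝ), 0 < r →
      F (r • (ζ : CSpace N)) = g ζ * h r) :
    ∫ z, F z = (∫ ζ, g ζ ∂(volume : Measure (CSpace N)).toSphere) *
      ∫ r in Set.Ioi (0 : ℝ), r ^ (2 * N - 1) * h r := by
  have hdim : Module.finrank ℝ (CSpace N) = 2 * N := by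
    rw [finrank_real_of_complex, finrank_euclideanSpace, Fintype.card_fin]
  calc ∫ z, F z = ∫ z : ({0}ᶜ : Set (CSpace N)), F z ∂(volume.comap Subtype.val) := by
        rw [integral_subtype_comap (measurableSet_singleton _).compl F, restrict_compl_singleton]
    _ = ∫ p : sphere (0 : CSpace N) 1 × Set.Ioi (0 : ℝ), g p.1 * h p.2
          ∂((volume : Measure (CSpace N)).toSphere.prod
            (Measure.volumeIoiPow (Module.finrank ℝ (CSpace N) - 1))) := by
        rw [← (volume : Measure (CSpace N)).measurePreserving_homeomorphUnitSphereProd.integral_comp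
          (Homeomorph.measurableEmbedding _)]
        refine integral_congr_ae (.of_forall fun z => ?_)
        have hz : ‖(z : CSpace N)‖ ≠ 0 := norm_ne_zero_iff.2 z.2
        have := hF (homeomorphUnitSphereProd (CSpace N) z).1
          (homeomorphUnitSphereProd (CSpace N) z).2 (homeomorphUnitSphereProd (CSpace N) z).2.2
        refine Eq.trans ?_ this
        simp [smul_smul, hz]
    _ = _ := by
        rw [integral_prod_mul (fun ζ => g ζ) (fun r : Set.Ioi (0 : ℝ) => h r), hdim]
        congr 1
        simp only [Measure.volumeIoiPow, ENNReal.ofReal]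
        rw [integral_withDensity_eq_integral_smul, integral_subtype_comap measurableSet_Ioi
          fun a : ℝ => Real.toNNReal (a ^ (2 * N - 1)) • h a]
        · refine setIntegral_congr_fun measurableSet_Ioi fun x hx => ?_
          simp only [NNReal.smul_def]
          rw [Real.coe_toNNReal _ (pow_nonneg (le_of_lt hx) _), smul_eq_mul]
        · exact (measurable_subtype_coe.pow_const _).real_toNNReal

theorem integral_pow_mul_exp_neg_sq_Ioi (n : ℕ) :
    ∫ r in Set.Ioi (0 : ℝ), r ^ (2 * n + 1) * Real.exp (-r ^ 2) = n.factorial / 2 := by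
  have h := integral_rpow_mul_exp_neg_rpow (p := 2) (q := 2 * n + 1) two_pos
    (by linarith [n.cast_nonneg (α := ℝ)])
  rw [show ((2 * n + 1 + 1 : ℝ) / 2) = n + 1 by ring, Real.Gamma_nat_eq_factorial] at h
  rw [show (n.factorial : ℝ) / 2 = 1 / 2 * n.factorial by ring, ← h]
  refine setIntegral_congr_fun measurableSet_Ioi fun x hx => ?_
  rw [← Real.rpow_natCast, ← Real.rpow_natCast]
  norm_num

theorem integral_norm_pow_mul_exp_neg_sq (k : ℕ) :
    ∫ x : ℂ, ‖x‖ ^ (2 * k) * Real.exp (-‖x‖ ^ 2) = Real.pi * k.factorial := by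
  have h := Complex.integral_rpow_mul_exp_neg_rpow (p := 2) (q := 2 * k) one_le_two
    (by linarith [k.cast_nonneg (α := ℝ)])
  rw [show ((2 * k + 2 : ℝ) / 2) = k + 1 by ring, Real.Gamma_nat_eq_factorial,
    show (2 * Real.pi / 2) = Real.pi by ring] at h
  rw [← h]
  refine integral_congr_ae (.of_forall fun x => ?_)
  simp only
  rw [← Real.rpow_natCast, ← Real.rpow_natCast]
  norm_num

/-- The Gaussian factorizes over the coordinates, each of which contributes π except the i-th, which
contributes π · k!. The factor relating the Euclidean volume to the product measure is left
unidentified: only ratios of these integrals are used. -/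
theorem exists_integral_gaussian (N : ℕ) : ∃ c : ℝ, ∀ (k : ℕ) (i : Fin N),
    ∫ z : CSpace N, ‖z i‖ ^ (2 * k) * Real.exp (-‖z‖ ^ 2) = c * k.factorial := by
  let e := (PiLp.continuousLinearEquiv 2 ℝ (fun _ : Fin N => ℂ)).symm
  obtain ⟨c, hc⟩ : ∃ c : NNReal,
      (volume : Measure (CSpace N)) = c • (volume : Measure (Fin N → ℂ)).map e :=
    ⟨_, Measure.isAddLeftInvariant_eq_smul _ _⟩
  refine ⟨c * Real.pi ^ N, fun k i => ?_⟩
  have h1 : ∀ x : Fin N → ℂ, ‖(e x) i‖ ^ (2 * k) * Real.exp (-‖e x‖ ^ 2) =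
      ∏ j, (‖x j‖ ^ (2 * if j = i then k else 0) * Real.exp (-‖x j‖ ^ 2)) := by
    intro x
    rw [Finset.prod_mul_distrib, ← Real.exp_sum, EuclideanSpace.norm_sq_eq, Finset.sum_neg_distrib]
    congr 1
    rw [Finset.prod_eq_single i (fun j _ hj => by simp [hj]) (by simp)]
    simp [e]
  rw [hc, integral_smul_nnreal_measure]
  have h2 := e.toHomeomorph.measurableEmbedding.integral_map (μ := volume)
    (fun z : CSpace N => ‖z i‖ ^ (2 * k) * Real.exp (-‖z‖ ^ 2))
  refine (congrArg (c • ·) h2).trans ?_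
  simp only [ContinuousLinearEquiv.coe_toHomeomorph, h1]
  rw [integral_fintype_prod_volume_eq_prod
    (fun j (x : ℂ) => ‖x‖ ^ (2 * if j = i then k else 0) * Real.exp (-‖x‖ ^ 2))]
  simp only [integral_norm_pow_mul_exp_neg_sq, Finset.prod_mul_distrib]
  rw [Finset.prod_const, Finset.prod_eq_single i (fun j _ hj => by simp [hj]) (by simp)]
  simp [NNReal.smul_def, mul_assoc]

/-- The same Gaussian integral in polar coordinates is the spherical moment times (k + N - 1)!/2.
Dividing by the case k = 0 eliminates both the unknown constant and the total mass of the sphere. -/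
theorem integral_sphere_coord (N : ℕ) [NeZero N] (i : Fin N) (k : ℕ) :
    ∫ ζ, ‖(ζ : CSpace N) i‖ ^ (2 * k) ∂(sphereMeasure N) =
      ((k + (N - 1)).choose (N - 1) : ℝ)⁻¹ := by
  obtain ⟨c, hc⟩ := exists_integral_gaussian N
  set I : ℕ → ℝ := fun k =>
    ∫ ζ, ‖(ζ : CSpace N) i‖ ^ (2 * k) ∂(volume : Measure (CSpace N)).toSphere
  have hN : 1 ≤ N := NeZero.one_le
  have h : ∀ k, c * k.factorial = I k * ((k + (N - 1)).factorial / 2) := by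
    intro k
    rw [← hc k i, integral_polar (g := fun ζ => ‖(ζ : CSpace N) i‖ ^ (2 * k))
      (h := fun r => r ^ (2 * k) * Real.exp (-r ^ 2)), ← integral_pow_mul_exp_neg_sq_Ioi]
    · congr 1
      refine integral_congr_ae (.of_forall fun r => ?_)
      simp only
      rw [← mul_assoc, ← pow_add]
      congr 2
      omega
    · intro ζ r hr
      simp [norm_smul, abs_of_pos hr]
      ring
  have hI : ∀ k, ∫ ζ, ‖(ζ : CSpace N) i‖ ^ (2 * k) ∂(sphereMeasure N) = I k / I 0 := by
    intro k
    simp [sphereMeasure, I, div_eq_inv_mul, Measure.real]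
  have h0 := h 0
  have hI0 : I 0 ≠ 0 := by
    simp only [I, mul_zero, pow_zero, integral_const, smul_eq_mul, mul_one, Measure.real]
    exact ENNReal.toReal_ne_zero.2
      ⟨by rw [Ne, Measure.measure_univ_eq_zero]; exact Measure.toSphere_ne_zero _,
        measure_ne_top _ _⟩
  have hk := h k
  rw [hI, Nat.add_choose]
  have := Nat.factorial_ne_zero
  simp only [Nat.factorial_zero, Nat.cast_one, mul_one, zero_add] at h0
  rw [h0] at hk
  rw [Nat.cast_div (Nat.factorial_mul_factorial_dvd_factorial_add _ _) (by positivity)]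
  push_cast
  field_simp at hk ⊢
  linarith

/-- The action of a linear isometry on the unit sphere. -/
def sphereIso {N : ℕ} (e : CSpace N ≃ₗᵢ[ℂ] CSpace N) (ζ : sphere (0 : CSpace N) 1) :
    sphere (0 : CSpace N) 1 := ⟨e ζ, by simp⟩

theorem continuous_sphereIso {N : ℕ} (e : CSpace N ≃ₗᵢ[ℂ] CSpace N) :
    Continuous (sphereIso e) :=
  (e.continuous.comp continuous_subtype_val).subtype_mk _

theorem measurePreserving_sphereIso {N : ℕ} (e : CSpace N ≃ₗᵢ[ℂ] CSpace N) :
    MeasurePreserving (sphereIso e) (sphereMeasure N) (sphereMeasure N) := by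
  have hc := continuous_sphereIso e
  have hr : ∀ (r : ℝ) x, e (r • x) = r • e x := fun r x => by
    rw [← Complex.coe_smul, map_smul, Complex.coe_smul]
  let e' : CSpace N ≃ₗᵢ[ℝ] CSpace N :=
    { e.toLinearEquiv.restrictScalars ℝ with norm_map' := e.norm_map }
  have h : MeasurePreserving (sphereIso e)
      (volume : Measure (CSpace N)).toSphere (volume : Measure (CSpace N)).toSphere := by
    refine ⟨hc.measurable, ?_⟩
    ext s hs
    rw [Measure.map_apply hc.measurable hs, Measure.toSphere_apply' _ (hc.measurable hs),
      Measure.toSphere_apply' _ hs]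
    congr 1
    rw [← e'.measurePreserving.measure_preimage_equiv (f := e'.toMeasurableEquiv)
      (Set.Ioo (0 : ℝ) 1 • (Subtype.val '' s))]
    congr 1
    ext x
    simp only [Set.mem_smul, Set.mem_image, Set.mem_preimage]
    constructor
    · rintro ⟨r, hr', _, ⟨ζ, hζ, rfl⟩, rfl⟩
      exact ⟨r, hr', _, ⟨_, hζ, rfl⟩, (hr r _).symm⟩
    · rintro ⟨r, hr', _, ⟨ζ, hζ, rfl⟩, hx⟩
      refine ⟨r, hr', _, ⟨sphereIso e.symm ζ, ?_, rfl⟩, ?_⟩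
      · have : sphereIso e (sphereIso e.symm ζ) = ζ := by
          ext1; simp [sphereIso]
        rwa [this]
      · refine e.injective ((hr r _).trans ?_)
        rw [show e ((sphereIso e.symm ζ : sphere (0 : CSpace N) 1) : CSpace N) = ζ by
          simp [sphereIso]]
        exact hx
  exact h.smul_measure _

theorem integral_sphereIso {N : ℕ} (e : CSpace N ≃ₗᵢ[ℂ] CSpace N) {E : Type*}
    [NormedAddCommGroup E] [NormedSpace ℝ E] {F : sphere (0 : CSpace N) 1 → E}
    (hF : Continuous F) :
    ∫ ζ, F (sphereIso e ζ) ∂(sphereMeasure N) = ∫ ζ, F ζ ∂(sphereMeasure N) := by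
  have h := measurePreserving_sphereIso e
  rw [← integral_map h.measurable.aemeasurable
    (by rw [h.map_eq]; exact hF.aestronglyMeasurable), h.map_eq]

theorem exists_orthonormalBasis_zero_eq {N : ℕ} [NeZero N] {e : CSpace N} (he : ‖e‖ = 1) :
    ∃ b : OrthonormalBasis (Fin N) ℂ (CSpace N), b 0 = e := by
  have hv : Orthonormal ℂ (Set.domRestrict ({0} : Set (Fin N)) fun _ => e) := by
    refine ⟨fun _ => he, fun i j hij => absurd (Subsingleton.elim i j) hij⟩
  obtain ⟨b, hb⟩ := hv.exists_orthonormalBasis_extension_of_card_eq (by simp)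
  exact ⟨b, hb 0 rfl⟩

/-- A unitary change of coordinates carries e to the first basis vector. -/
theorem integral_sphere_inner {N : ℕ} [NeZero N] {e : CSpace N} (he : ‖e‖ = 1) (k : ℕ) :
    ∫ ζ, ‖inner ℂ e (ζ : CSpace N)‖ ^ (2 * k) ∂(sphereMeasure N) =
      ((k + (N - 1)).choose (N - 1) : ℝ)⁻¹ := by
  obtain ⟨b, rfl⟩ := exists_orthonormalBasis_zero_eq he
  rw [← integral_sphere_coord N 0 k]
  rw [← integral_sphereIso b.repr (F := fun ζ => ‖(ζ : CSpace N) 0‖ ^ (2 * k)) (by fun_prop)]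
  simp [sphereIso, b.repr_apply_apply]

theorem norm_sq_inner_smul_add_smul {N : ℕ} {e : CSpace N} (he : ‖e‖ = 1) (u : ℂ)
    (z : CSpace N) :
    ‖inner ℂ e z • e + u • (z - inner ℂ e z • e)‖ ^ 2 =
      ‖inner ℂ e z • e‖ ^ 2 + ‖u‖ ^ 2 * ‖z - inner ℂ e z • e‖ ^ 2 := by
  have h0 : inner ℂ (inner ℂ e z • e) (u • (z - inner ℂ e z • e)) = 0 := by
    rw [inner_smul_left, inner_smul_right, inner_sub_right, inner_smul_right,
      inner_self_eq_norm_sq_to_K, he]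
    simp
  have h1 := norm_add_sq_eq_norm_sq_add_norm_sq_of_inner_eq_zero _ _ h0
  rw [norm_smul u] at h1
  linarith

theorem norm_sq_eq_add_sub {N : ℕ} {e : CSpace N} (he : ‖e‖ = 1) (z : CSpace N) :
    ‖z‖ ^ 2 = ‖inner ℂ e z • e‖ ^ 2 + ‖z - inner ℂ e z • e‖ ^ 2 := by
  simpa using norm_sq_inner_smul_add_smul he 1 z

/-- The unitary map that is the identity on `ℂe` and multiplication by `u` on its complement. -/
def rotAbout {N : ℕ} {e : CSpace N} (he : ‖e‖ = 1) {u : ℂ} (hu : ‖u‖ = 1) :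
    CSpace N ≃ₗᵢ[ℂ] CSpace N :=
  LinearIsometry.toLinearIsometryEquiv
    { toLinearMap := u • LinearMap.id + (1 - u) • (innerSL ℂ e).toLinearMap.smulRight e
      norm_map' := fun z => by
        have h3 : inner ℂ e z • e + u • (z - inner ℂ e z • e) =
            u • z + (1 - u) • inner ℂ e z • e := by module
        have h := norm_sq_inner_smul_add_smul he u z
        rw [hu, one_pow, one_mul, ← norm_sq_eq_add_sub he, h3] at h
        exact (pow_left_inj₀ (norm_nonneg _) (norm_nonneg _) two_ne_zero).1 h } rfl

theorem rotAbout_apply {N : ℕ} {e : CSpace N} (he : ‖e‖ = 1) {u : ℂ} (hu : ‖u‖ = 1)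
    (z : CSpace N) :
    rotAbout he hu z = inner ℂ e z • e + u • (z - inner ℂ e z • e) := by
  change u • z + (1 - u) • inner ℂ e z • e = _
  module

theorem inner_rotAbout {N : ℕ} {e : CSpace N} (he : ‖e‖ = 1) {u : ℂ} (hu : ‖u‖ = 1)
    (z : CSpace N) : inner ℂ e (rotAbout he hu z) = inner ℂ e z := by
  simp [rotAbout_apply, he]

end

/-! ### The reproducing integral of the Szegő kernel. -/

section

theorem integral_circleProb_eq {g : ℂ → ℂ} (hg : ∀ l : ℂ, ‖l‖ ≤ 1 → DifferentiableAt ℂ g l) :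
    ∫ t, g (circleMap 0 1 t) ∂circleProb = g 0 := by
  rw [← circleAverage_of_differentiable_on_off_countable (c := 0) (R := 1)
    (f := g) (s := ∅) Set.countable_empty
    (fun l hl => (hg l (by simpa using hl)).continuousAt.continuousWithinAt)
    (fun l hl => hg l (by simpa using ball_subset_closedBall hl.1)),
    Real.circleAverage, intervalIntegral.integral_of_le (by positivity), circleProb,
    integral_smul_measure, ENNReal.toReal_ofReal (by positivity)]

theorem norm_inner_sphere_le {N : ℕ} {e : CSpace N} (he : ‖e‖ = 1) (ζ : sphere (0 : CSpace N) 1) :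
    ‖inner ℂ e (ζ : CSpace N)‖ ≤ 1 := by
  simpa [he] using norm_inner_le_norm (𝕜 := ℂ) e (ζ : CSpace N)

variable {N : ℕ} [NeZero N]

theorem integral_inner_pow_mul {e : CSpace N} (he : ‖e‖ = 1) (k j : ℕ) :
    ∫ ζ, conj (inner ℂ e (ζ : CSpace N)) ^ k * inner ℂ e (ζ : CSpace N) ^ j ∂(sphereMeasure N) =
      if k = j then ((k + (N - 1)).choose (N - 1) : ℂ)⁻¹ else 0 := by
  split_ifs with hkj
  · subst hkj
    have h := congrArg (fun x : ℝ => (x : ℂ)) (integral_sphere_inner he k)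
    simp only [← integral_complex_ofReal] at h
    push_cast at h
    rw [← h]
    refine integral_congr_ae (.of_forall fun ζ => ?_)
    simp only
    rw [← mul_pow, Complex.conj_mul', ← pow_mul]
  · have hkj' : (j : ℂ) - k ≠ 0 := sub_ne_zero.2 fun h => hkj (by exact_mod_cast h.symm)
    -- This u satisfies u^{j-k} = -1, so the rotation ζ ↦ uζ changes the sign of the integrand while
    -- preserving σ; the integral equals its own negative.
    set u : ℂ := Complex.exp ((Real.pi / (j - k) : ℝ) * Complex.I) with hu
    have hu1 : ‖u‖ = 1 := Complex.norm_exp_ofReal_mul_I _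
    have hu2 : conj u ^ k * u ^ j = -1 := by
      rw [hu, ← Complex.exp_conj, ← Complex.exp_nat_mul, ← Complex.exp_nat_mul, ← Complex.exp_add,
        ← Complex.exp_pi_mul_I]
      congr 1
      simp only [map_mul, Complex.conj_ofReal, Complex.conj_I]
      push_cast
      field_simp
      ring
    have h := sphereRot_measurePreserving (N := N) u hu1
    have hc : Continuous fun ζ : sphere (0 : CSpace N) 1 =>
        conj (inner ℂ e (ζ : CSpace N)) ^ k * inner ℂ e (ζ : CSpace N) ^ j := by fun_prop
    have h2 := integral_map (μ := sphereMeasure N) h.measurable.aemeasurable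
      hc.aestronglyMeasurable
    rw [h.map_eq] at h2
    have h3 : ∀ ζ : sphere (0 : CSpace N) 1,
        conj (inner ℂ e (sphereRot u hu1 ζ : CSpace N)) ^ k *
          inner ℂ e (sphereRot u hu1 ζ : CSpace N) ^ j =
        -1 * (conj (inner ℂ e (ζ : CSpace N)) ^ k * inner ℂ e (ζ : CSpace N) ^ j) := by
      intro ζ
      rw [← hu2]
      simp only [sphereRot, inner_smul_right, map_mul]
      ring
    simp only [h3, integral_const_mul] at h2
    linear_combination h2 / 2

theorem hasSum_integral_sphere {F : ℕ → sphere (0 : CSpace N) 1 → ℂ} {b : ℕ → ℝ}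
    (hF : ∀ n, Continuous (F n)) (hb : Summable b) (hFb : ∀ n ζ, ‖F n ζ‖ ≤ b n) :
    HasSum (fun n => ∫ ζ, F n ζ ∂(sphereMeasure N)) (∫ ζ, ∑' n, F n ζ ∂(sphereMeasure N)) := by
  refine hasSum_integral_of_summable_integral_norm
    (fun n => (hF n).integrable_of_hasCompactSupport (HasCompactSupport.of_compactSpace _)) ?_
  refine hb.of_nonneg_of_le (fun n => integral_nonneg fun ζ => norm_nonneg _) fun n => ?_
  refine (integral_mono ((hF n).norm.integrable_of_hasCompactSupport
    (HasCompactSupport.of_compactSpace _)) (integrable_const (b n)) (hFb n)).trans ?_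
  simp

/-- The unitaries that fix e and multiply its complement by a unimodular l preserve both σ and ⟨ζ,
e⟩. Averaging over l, the mean value property in l replaces f(rζ) by its value at l = 0, the
projection of rζ to ℂe. This reduces the reproducing property to one complex variable. -/
theorem integral_mul_eq_integral_slice {f : CSpace N → ℂ} (hf : DifferentiableOn ℂ f (ball 0 1))
    {e : CSpace N} (he : ‖e‖ = 1) {r : ℝ} (hr : r ∈ Set.Ioo (0 : ℝ) 1) {Φ : ℂ → ℂ}
    (hΦ : Continuous fun ζ : sphere (0 : CSpace N) 1 => Φ (inner ℂ e (ζ : CSpace N))) :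
    ∫ ζ, Φ (inner ℂ e (ζ : CSpace N)) * f ((r : ℂ) • (ζ : CSpace N)) ∂(sphereMeasure N) =
      ∫ ζ, Φ (inner ℂ e (ζ : CSpace N)) * f (((r : ℂ) * inner ℂ e (ζ : CSpace N)) • e)
        ∂(sphereMeasure N) := by
  have hcm : ∀ t : ℝ, ‖circleMap 0 1 t‖ = 1 := by intro t; simp
  let T : sphere (0 : CSpace N) 1 → ℂ → CSpace N := fun ζ l =>
    (r : ℂ) • (inner ℂ e (ζ : CSpace N) • e + l • ((ζ : CSpace N) - inner ℂ e (ζ : CSpace N) • e))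
  have hTr : ∀ ζ t, T ζ (circleMap 0 1 t) =
      (r : ℂ) • ((sphereIso (rotAbout he (hcm t)) ζ : sphere (0 : CSpace N) 1) : CSpace N) := by
    intro ζ t
    simp only [T, sphereIso, rotAbout_apply]
  have hTn : ∀ ζ t, ‖T ζ (circleMap 0 1 t)‖ = r := by
    intro ζ t
    rw [hTr, norm_smul, norm_eq_of_mem_sphere, mul_one, Complex.norm_real,
      Real.norm_of_nonneg hr.1.le]
  have hTb : ∀ ζ (l : ℂ), ‖l‖ ≤ 1 → T ζ l ∈ ball (0 : CSpace N) 1 := by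
    intro ζ l hl
    have h1 := norm_sq_inner_smul_add_smul he l (ζ : CSpace N)
    have h2 := norm_sq_eq_add_sub he (ζ : CSpace N)
    rw [norm_eq_of_mem_sphere] at h2
    have h3 : ‖inner ℂ e (ζ : CSpace N) • e + l • ((ζ : CSpace N) -
        inner ℂ e (ζ : CSpace N) • e)‖ ^ 2 ≤ 1 ^ 2 := by
      rw [h1, h2]
      have := mul_le_of_le_one_left (sq_nonneg ‖(ζ : CSpace N) - inner ℂ e (ζ : CSpace N) • e‖)
        (pow_le_one₀ (norm_nonneg l) hl (n := 2))
      linarith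
    have h4 := (pow_le_pow_iff_left₀ (norm_nonneg _) zero_le_one two_ne_zero).1 h3
    rw [mem_ball_zero_iff, norm_smul, Complex.norm_real, Real.norm_of_nonneg hr.1.le]
    nlinarith [hr.1, hr.2]
  let G : sphere (0 : CSpace N) 1 → ℝ → ℂ := fun ζ t =>
    Φ (inner ℂ e (ζ : CSpace N)) * f (T ζ (circleMap 0 1 t))
  have hGc : Continuous (Function.uncurry G) := by
    refine (hΦ.comp continuous_fst).mul (hf.continuousOn.comp_continuous
      (f := fun p : sphere (0 : CSpace N) 1 × ℝ => T p.1 (circleMap 0 1 p.2)) ?_ fun p =>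
      hTb _ _ (hcm _).le)
    have := (continuous_circleMap 0 1).comp (continuous_snd (X := sphere (0 : CSpace N) 1))
    simp only [Function.comp_def] at this
    fun_prop
  obtain ⟨C, hC⟩ : ∃ C, ∀ x ∈ closedBall (0 : CSpace N) r, ‖f x‖ ≤ C :=
    (isCompact_closedBall _ _).exists_bound_of_continuousOn
      (hf.continuousOn.mono (closedBall_subset_ball hr.2))
  obtain ⟨D, hD⟩ := isCompact_univ.exists_bound_of_continuousOn hΦ.continuousOn
  have hint : Integrable (Function.uncurry G) ((sphereMeasure N).prod circleProb) := by
    refine Integrable.of_bound hGc.aestronglyMeasurable (D * C) (.of_forall fun p => ?_)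
    rw [Function.uncurry_def, norm_mul]
    exact mul_le_mul (hD _ trivial) (hC _ (by simp [hTn])) (norm_nonneg _)
      ((norm_nonneg _).trans (hD p.1 trivial))
  calc _ = ∫ t, ∫ ζ, G ζ t ∂(sphereMeasure N) ∂circleProb := by
        have h1 : ∀ t, ∫ ζ, G ζ t ∂(sphereMeasure N) = ∫ ζ, Φ (inner ℂ e (ζ : CSpace N)) *
            f ((r : ℂ) • (ζ : CSpace N)) ∂(sphereMeasure N) := by
          intro t
          rw [← integral_sphereIso (rotAbout he (hcm t)) (F := fun ζ =>
            Φ (inner ℂ e (ζ : CSpace N)) * f ((r : ℂ) • (ζ : CSpace N)))]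
          · simp only [G, hTr]
            simp only [sphereIso, inner_rotAbout]
          · exact hΦ.mul (continuous_slice hf.continuousOn (c := (r : ℂ))
              (by simpa [abs_of_pos hr.1] using hr.2))
        simp [h1]
    _ = ∫ ζ, ∫ t, G ζ t ∂circleProb ∂(sphereMeasure N) := (integral_integral_swap hint).symm
    _ = _ := by
        refine integral_congr_ae (.of_forall fun ζ => ?_)
        simp only [G, integral_const_mul]
        rw [integral_circleProb_eq (g := fun l => f (T ζ l))]
        · simp [T, smul_smul]
        · intro l hl
          have h1 : DifferentiableAt ℂ f (T ζ l) :=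
            hf.differentiableAt (isOpen_ball.mem_nhds (hTb ζ l hl))
          exact h1.comp l (by fun_prop)

/-- The binomial coefficients in the series of (1 - x)^{-N} are the reciprocals of the moments of
⟨ζ, e⟩, so orthogonality of the powers leaves exactly q^j. -/
theorem integral_conj_szego_mul_pow {e : CSpace N} (he : ‖e‖ = 1) {q : ℝ}
    (hq : q ∈ Set.Ico (0 : ℝ) 1) (j : ℕ) :
    ∫ ζ, conj (1 / (1 - q * inner ℂ e (ζ : CSpace N)) ^ N) * inner ℂ e (ζ : CSpace N) ^ j
      ∂(sphereMeasure N) = (q : ℂ) ^ j := by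
  have hN : N - 1 + 1 = N := Nat.sub_add_cancel NeZero.one_le
  have hqn : ‖(q : ℂ)‖ < 1 := by simpa [abs_of_nonneg hq.1] using hq.2
  let F : ℕ → sphere (0 : CSpace N) 1 → ℂ := fun k ζ =>
    ((k + (N - 1)).choose (N - 1) * q ^ k : ℂ) *
      (conj (inner ℂ e (ζ : CSpace N)) ^ k * inner ℂ e (ζ : CSpace N) ^ j)
  have hs : ∀ ζ, HasSum (fun k => F k ζ)
      (conj (1 / (1 - q * inner ℂ e (ζ : CSpace N)) ^ N) * inner ℂ e (ζ : CSpace N) ^ j) := by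
    intro ζ
    have h1 : ‖q * conj (inner ℂ e (ζ : CSpace N))‖ < 1 := by
      rw [norm_mul, RCLike.norm_conj]
      nlinarith [norm_inner_sphere_le he ζ, norm_nonneg (q : ℂ)]
    have h2 := (hasSum_choose_mul_geometric_of_norm_lt_one (N - 1) h1).mul_right
      (inner ℂ e (ζ : CSpace N) ^ j)
    rw [hN] at h2
    have h3 : (fun k => F k ζ) = fun k => ((k + (N - 1)).choose (N - 1) : ℂ) *
        (q * conj (inner ℂ e (ζ : CSpace N))) ^ k * inner ℂ e (ζ : CSpace N) ^ j := by
      funext k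
      simp only [F]
      ring
    have h4 : conj (1 / (1 - q * inner ℂ e (ζ : CSpace N)) ^ N) =
        1 / (1 - q * conj (inner ℂ e (ζ : CSpace N))) ^ N := by
      simp only [map_div₀, map_pow, map_sub, map_mul, map_one, Complex.conj_ofReal]
    rw [h3, h4]
    exact h2
  have hb : Summable fun k => ((k + (N - 1)).choose (N - 1) * q ^ k : ℝ) :=
    summable_choose_mul_geometric_of_norm_lt_one (N - 1)
      (by simpa [abs_of_nonneg hq.1] using hq.2)
  have h := hasSum_integral_sphere (F := F) (fun k => by fun_prop) hb (fun k ζ => by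
    have h1 := norm_inner_sphere_le he ζ
    simp only [F, norm_mul, norm_pow, RCLike.norm_conj, Complex.norm_natCast, Complex.norm_real,
      Real.norm_of_nonneg hq.1]
    exact mul_le_of_le_one_right (by have := hq.1; positivity)
      (mul_le_one₀ (pow_le_one₀ (norm_nonneg _) h1) (by positivity)
        (pow_le_one₀ (norm_nonneg _) h1)))
  simp only [(hs _).tsum_eq] at h
  refine h.unique ?_
  have h3 : ∀ k, ∫ ζ, F k ζ ∂(sphereMeasure N) = if k = j then (q : ℂ) ^ j else 0 := by
    intro k
    simp only [F, integral_const_mul, integral_inner_pow_mul he]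
    split_ifs with hkj
    · subst hkj
      have : ((k + (N - 1)).choose (N - 1) : ℂ) ≠ 0 := by
        exact_mod_cast (Nat.choose_pos (Nat.le_add_left _ _)).ne'
      field_simp
    · simp
  simp only [h3]
  exact hasSum_ite_eq j _

/-- With w = ‖w‖e the kernel depends on ⟨ζ, e⟩ alone, so f may be replaced by its slice along e,
whose Taylor series is integrated termwise. The value appears at r²w because one factor r comes from
the kernel and one from f. -/
theorem integral_conj_szego_mul {f : CSpace N → ℂ} (hf : DifferentiableOn ℂ f (ball 0 1))
    {w : CSpace N} (hw : w ∈ ball (0 : CSpace N) 1) {r : ℝ} (hr : r ∈ Set.Ioo (0 : ℝ) 1) :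
    ∫ ζ, conj (1 / (1 - inner ℂ w ((r : ℂ) • (ζ : CSpace N))) ^ N) *
      f ((r : ℂ) • (ζ : CSpace N)) ∂(sphereMeasure N) = f (((r ^ 2 : ℝ) : ℂ) • w) := by
  obtain ⟨e, he, hwe⟩ : ∃ e : CSpace N, ‖e‖ = 1 ∧ w = (‖w‖ : ℂ) • e := by
    rcases eq_or_ne w 0 with rfl | h0
    · obtain ⟨e, he⟩ := exists_norm_eq (CSpace N) zero_le_one
      exact ⟨e, he, by simp⟩
    · refine ⟨(‖w‖ : ℂ)⁻¹ • w, ?_, ?_⟩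
      · simp [norm_smul, h0]
      · rw [smul_smul, mul_inv_cancel₀ (by simpa using h0), one_smul]
  set s := ‖w‖ with hs
  have hs1 : s < 1 := by simpa using hw
  have hs0 : 0 ≤ s := norm_nonneg _
  have hq : r * s ∈ Set.Ico (0 : ℝ) 1 := ⟨mul_nonneg hr.1.le hs0, by nlinarith [hr.1, hr.2]⟩
  have hqi : ∀ ζ : sphere (0 : CSpace N) 1, inner ℂ w ((r : ℂ) • (ζ : CSpace N)) =
      ((r * s : ℝ) : ℂ) * inner ℂ e (ζ : CSpace N) := by
    intro ζ
    rw [hwe, inner_smul_left, inner_smul_right]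
    simp
    ring
  have hne : ∀ ζ : sphere (0 : CSpace N) 1,
      (1 - ((r * s : ℝ) : ℂ) * inner ℂ e (ζ : CSpace N)) ^ N ≠ 0 := by
    intro ζ
    refine pow_ne_zero _ (sub_ne_zero.2 fun h => ?_)
    have h1 := congrArg norm h
    rw [norm_one, norm_mul, Complex.norm_real, Real.norm_of_nonneg hq.1] at h1
    nlinarith [norm_inner_sphere_le he ζ, hq.1, hq.2]
  have hΦ : Continuous fun ζ : sphere (0 : CSpace N) 1 =>
      conj (1 / (1 - ((r * s : ℝ) : ℂ) * inner ℂ e (ζ : CSpace N)) ^ N) :=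
    Complex.continuous_conj.comp (continuous_const.div (by fun_prop) hne)
  simp only [hqi]
  rw [integral_mul_eq_integral_slice hf he hr
    (Φ := fun x => conj (1 / (1 - ((r * s : ℝ) : ℂ) * x) ^ N)) hΦ]
  have hgd : DifferentiableOn ℂ (fun l : ℂ => f (l • e)) (ball 0 1) := by
    refine hf.comp (by fun_prop) fun l hl => ?_
    simpa [norm_smul, he] using hl
  set a : ℕ → ℂ := fun n => (n.factorial : ℂ)⁻¹ * iteratedDeriv n (fun l : ℂ => f (l • e)) 0
  have ha : ∀ l : ℂ, ‖l‖ < 1 → HasSum (fun n => a n * l ^ n) (f (l • e)) := by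
    intro l hl
    refine (Complex.hasSum_taylorSeries_on_ball hgd (z := l) (by simpa using hl)).congr_fun
      fun n => ?_
    simp only [a, sub_zero, smul_eq_mul]
    ring
  obtain ⟨D, hD⟩ := isCompact_univ.exists_bound_of_continuousOn hΦ.continuousOn
  let F : ℕ → sphere (0 : CSpace N) 1 → ℂ := fun n ζ => (a n * r ^ n) *
    (conj (1 / (1 - ((r * s : ℝ) : ℂ) * inner ℂ e (ζ : CSpace N)) ^ N) *
      inner ℂ e (ζ : CSpace N) ^ n)
  -- The majorant is the Taylor series of the slice, absolutely convergent at the interior point r,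
  -- times a bound D for the kernel on the sphere.
  have hsum : Summable fun n => ‖a n * (r : ℂ) ^ n‖ * D :=
    ((ha r (by simpa [abs_of_pos hr.1] using hr.2)).summable.norm).mul_right D
  have h := hasSum_integral_sphere (F := F) (fun n => continuous_const.mul
    (hΦ.mul (by fun_prop))) hsum (fun n ζ => by
      rw [norm_mul, norm_mul (conj _)]
      refine mul_le_mul_of_nonneg_left ?_ (norm_nonneg _)
      refine (mul_le_of_le_one_right (norm_nonneg _) ?_).trans (hD ζ trivial)
      rw [norm_pow]
      exact pow_le_one₀ (norm_nonneg _) (norm_inner_sphere_le he ζ))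
  have h1 : ∀ ζ : sphere (0 : CSpace N) 1, HasSum (fun n => F n ζ)
      (conj (1 / (1 - ((r * s : ℝ) : ℂ) * inner ℂ e (ζ : CSpace N)) ^ N) *
        f (((r : ℂ) * inner ℂ e (ζ : CSpace N)) • e)) := by
    intro ζ
    have h2 : ‖(r : ℂ) * inner ℂ e (ζ : CSpace N)‖ < 1 := by
      rw [norm_mul, Complex.norm_real, Real.norm_of_nonneg hr.1.le]
      nlinarith [norm_inner_sphere_le he ζ, hr.1, hr.2]
    refine ((ha _ h2).mul_left
      (conj (1 / (1 - ((r * s : ℝ) : ℂ) * inner ℂ e (ζ : CSpace N)) ^ N))).congr_fun fun n => ?_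
    simp only [F]
    ring
  simp only [(h1 _).tsum_eq] at h
  refine h.unique ?_
  have h2 : ‖((r ^ 2 * s : ℝ) : ℂ)‖ < 1 := by
    rw [Complex.norm_real, Real.norm_of_nonneg (by positivity)]
    nlinarith [hr.1, hr.2]
  have h3 : ((r ^ 2 : ℝ) : ℂ) • w = ((r ^ 2 * s : ℝ) : ℂ) • e := by
    conv_lhs => rw [hwe, smul_smul]
    push_cast
    rfl
  rw [h3]
  refine (ha _ h2).congr_fun fun n => ?_
  simp only [F, integral_const_mul]
  rw [integral_conj_szego_mul_pow he hq]
  push_cast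
  ring

end

/-! ### The Szegő kernel in H², and boundedness from positivity. -/

section

open scoped ComplexOrder

variable {N : ℕ} [NeZero N]

theorem indicator_mem_hardySubmodule {f : CSpace N → ℂ} (hf : DifferentiableOn ℂ f (ball 0 1))
    {M : ℝ} (hM : ∀ z ∈ ball (0 : CSpace N) 1, ‖f z‖ ≤ M) :
    (ball (0 : CSpace N) 1).indicator f ∈ hardySubmodule N := by
  have hd : DifferentiableOn ℂ ((ball (0 : CSpace N) 1).indicator f) (ball 0 1) :=
    hf.congr fun z hz => Set.indicator_of_mem hz f
  refine ⟨hd, fun z hz => Set.indicator_of_notMem hz f, M ^ 2, ?_⟩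
  rintro _ ⟨r, hr, rfl⟩
  have hin : ∀ ζ : sphere (0 : CSpace N) 1, (r : ℂ) • (ζ : CSpace N) ∈ ball (0 : CSpace N) 1 := by
    intro ζ
    simpa [norm_smul, abs_of_pos hr.1] using hr.2
  refine (integral_mono (integrable_slice hd.continuousOn hr) (integrable_const (M ^ 2))
    fun ζ => ?_).trans (by simp)
  simp only [Set.indicator_of_mem (hin ζ)]
  exact pow_le_pow_left₀ (norm_nonneg _) (hM _ (hin ζ)) 2

theorem norm_inner_lt_one {E : Type*} [NormedAddCommGroup E] [InnerProductSpace ℂ E] {w z : E}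
    (hw : ‖w‖ < 1) (hz : ‖z‖ < 1) : ‖inner ℂ w z‖ < 1 :=
  (norm_inner_le_norm w z).trans_lt (by nlinarith [norm_nonneg w, norm_nonneg z])

theorem one_sub_ne_zero_of_norm_lt_one {x : ℂ} (hx : ‖x‖ < 1) : 1 - x ≠ 0 :=
  sub_ne_zero.2 fun h => by simp [← h] at hx

/-- The Szegő kernel function `z ↦ (1 - ⟨z, w⟩)^{-N}` as an element of the Hardy space. -/
def szego (w : ball (0 : CSpace N) 1) : HardySpace N :=
  ⟨(ball (0 : CSpace N) 1).indicator fun z => 1 / (1 - inner ℂ (w : CSpace N) z) ^ N, by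
    have hw : ‖(w : CSpace N)‖ < 1 := mem_ball_zero_iff.1 w.2
    refine indicator_mem_hardySubmodule (M := 1 / (1 - ‖(w : CSpace N)‖) ^ N) ?_ ?_
    · intro z hz
      refine DifferentiableAt.differentiableWithinAt ?_
      have h1 : DifferentiableAt ℂ (fun z => (1 - innerSL ℂ (w : CSpace N) z) ^ N) z := by fun_prop
      have h2 : (1 - innerSL ℂ (w : CSpace N) z) ^ N ≠ 0 := pow_ne_zero _
        (one_sub_ne_zero_of_norm_lt_one (norm_inner_lt_one hw (mem_ball_zero_iff.1 hz)))
      simp only [one_div]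
      exact h1.inv h2
    · intro z hz
      have hz' : ‖z‖ < 1 := by simpa using hz
      rw [norm_div, norm_one, norm_pow]
      have h0 : 0 < 1 - ‖(w : CSpace N)‖ := by linarith
      refine one_div_le_one_div_of_le (by positivity) (pow_le_pow_left₀ h0.le ?_ _)
      have h1 := norm_sub_norm_le (1 : ℂ) (inner ℂ (w : CSpace N) z)
      have h2 := norm_inner_le_norm (𝕜 := ℂ) (w : CSpace N) z
      rw [norm_one] at h1
      nlinarith [norm_nonneg (w : CSpace N)]⟩

theorem szego_apply (w : ball (0 : CSpace N) 1) {z : CSpace N} (hz : z ∈ ball (0 : CSpace N) 1) :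
    szego w z = 1 / (1 - inner ℂ (w : CSpace N) z) ^ N :=
  Set.indicator_of_mem hz fun z => 1 / (1 - inner ℂ (w : CSpace N) z) ^ N

/-- The reproducing property of the Szegő kernel. -/
theorem inner_szego (w : ball (0 : CSpace N) 1) (f : HardySpace N) :
    inner ℂ (szego w) f = f w := by
  have h1 : ∀ r ∈ Set.Ioo (0 : ℝ) 1, HardySpace.pairMean (szego w) f r =
      f (((r ^ 2 : ℝ) : ℂ) • (w : CSpace N)) := by
    intro r hr
    rw [← integral_conj_szego_mul f.differentiableOn w.2 hr]
    refine integral_congr_ae (.of_forall fun ζ => ?_)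
    simp only
    rw [szego_apply]
    simpa [norm_smul, abs_of_pos hr.1] using hr.2
  refine tendsto_nhds_unique (HardySpace.tendsto_pairMean (szego w) f) ?_
  refine Tendsto.congr' (HardySpace.eventually_mem.mono fun r hr => (h1 r hr).symm) ?_
  have h2 : ContinuousAt f (w : CSpace N) :=
    (f.differentiableOn.differentiableAt (isOpen_ball.mem_nhds w.2)).continuousAt
  have h3 : Continuous fun r : ℝ => ((r ^ 2 : ℝ) : ℂ) • (w : CSpace N) := by fun_prop
  have h4 : Tendsto (fun r : ℝ => ((r ^ 2 : ℝ) : ℂ) • (w : CSpace N)) (𝓝[<] 1)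
      (𝓝 (w : CSpace N)) := by
    have := h3.tendsto 1
    simp only [one_pow, Complex.ofReal_one, one_smul] at this
    exact this.mono_left nhdsWithin_le_nhds
  exact h2.tendsto.comp h4

theorem HardySpace.ext_ball {f g : HardySpace N} (h : ∀ z : ball (0 : CSpace N) 1, f z = g z) :
    f = g := by
  refine DFunLike.coe_injective (funext fun z => ?_)
  by_cases hz : z ∈ ball (0 : CSpace N) 1
  · exact h ⟨z, hz⟩
  · rw [f.eq_zero_of_notMem hz, g.eq_zero_of_notMem hz]

/-- A function orthogonal to every kernel vanishes at every point of the ball, by the reproducing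
property. -/
theorem denseRange_linearCombination_szego :
    DenseRange (Finsupp.linearCombination ℂ (szego (N := N))) := by
  have h : (Submodule.span ℂ (Set.range (szego (N := N)))).topologicalClosure = ⊤ := by
    rw [Submodule.topologicalClosure_eq_top_iff, Submodule.eq_bot_iff]
    intro f hf
    refine HardySpace.ext_ball fun z => ?_
    rw [← inner_szego]
    exact hf _ (Submodule.subset_span ⟨z, rfl⟩)
  rw [← Submodule.dense_iff_topologicalClosure_eq_top, ← Finsupp.range_linearCombination] at h
  exact h

theorem continuousLinearMap_ext_szego {S T : HardySpace N →L[ℂ] HardySpace N}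
    (h : ∀ w z : ball (0 : CSpace N) 1, S (szego w) z = T (szego w) z) : S = T := by
  refine ContinuousLinearMap.ext_on (s := Set.range (szego (N := N))) ?_ ?_
  · have := denseRange_linearCombination_szego (N := N)
    rwa [DenseRange, ← LinearMap.coe_range, Finsupp.range_linearCombination] at this
  · rintro _ ⟨w, rfl⟩
    exact HardySpace.ext_ball (h w)

/-! ### Positive semidefinite kernels on an arbitrary index set. -/

section PosSemidef

open Matrix

variable {ι E F : Type*} [NormedAddCommGroup E] [InnerProductSpace ℂ E]
  [NormedAddCommGroup F] [InnerProductSpace ℂ F]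

theorem sum_star_mul_gram_mul (v : ι → E) (c : ι →₀ ℂ) :
    (c.sum fun i ci => c.sum fun j cj => star ci * gram ℂ v i j * cj) =
      ((‖Finsupp.linearCombination ℂ v c‖ ^ 2 : ℝ) : ℂ) := by
  have := inner_self_eq_norm_sq_to_K (𝕜 := ℂ) (Finsupp.linearCombination ℂ v c)
  push_cast
  refine Eq.trans ?_ this
  simp only [Finsupp.linearCombination_apply, Finsupp.sum, sum_inner]
  simp only [inner_sum, inner_smul_left, inner_smul_right, gram_apply]
  refine Finset.sum_congr rfl fun i _ => Finset.sum_congr rfl fun j _ => ?_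
  simp only [RCLike.star_def]
  ring

theorem posSemidef_gram_of_any (v : ι → E) : (gram ℂ v).PosSemidef := by
  refine ⟨isHermitian_gram ℂ v, fun c => ?_⟩
  rw [sum_star_mul_gram_mul]
  exact Complex.zero_le_real.2 (sq_nonneg _)

/-- Iterated Schur product theorem; the zeroth power is the all-ones matrix, the Gram matrix of a
constant. -/
theorem posSemidef_hadamardPow {M : Matrix ι ι ℂ} (hM : M.PosSemidef) (k : ℕ) :
    (Matrix.of fun i j => M i j ^ k).PosSemidef := by
  induction k with
  | zero =>
    have h : (Matrix.of fun i j => M i j ^ 0) = gram ℂ fun _ : ι => (1 : ℂ) := by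
      ext i j
      simp
    rw [h]
    exact posSemidef_gram_of_any _
  | succ k ih =>
    have h : (Matrix.of fun i j => M i j ^ (k + 1)) = (Matrix.of fun i j => M i j ^ k) ⊙ M := by
      ext i j
      simp [pow_succ]
    rw [h]
    exact ih.hadamard hM

theorem posSemidef_of_hasSum {M : ℕ → Matrix ι ι ℂ} {A : Matrix ι ι ℂ}
    (hM : ∀ k, (M k).PosSemidef) (hA : ∀ i j, HasSum (fun k => M k i j) (A i j)) :
    A.PosSemidef := by
  refine ⟨Matrix.ext fun i j => ?_, fun c => ?_⟩
  · have h := (hA j i).star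
    refine HasSum.unique (L := .unconditional ℕ) h ((hA i j).congr_fun fun k => ?_)
    exact congrFun (congrFun (hM k).1 i) j
  · refine HasSum.nonneg (L := .unconditional ℕ) (fun k => (hM k).2 c) ?_
    exact hasSum_sum fun i _ => hasSum_sum fun j _ => ((hA i j).mul_left _).mul_right _

/-- The geometric series is an entrywise convergent sum of Hadamard powers of a Gram matrix. -/
theorem posSemidef_inv_one_sub_inner {v : ι → E} (hv : ∀ i, ‖v i‖ < 1) :
    (Matrix.of fun i j => (1 - inner ℂ (v i) (v j))⁻¹).PosSemidef :=
  posSemidef_of_hasSum (fun k => posSemidef_hadamardPow (posSemidef_gram_of_any v) k)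
    fun i j => hasSum_geometric_of_norm_lt_one (norm_inner_lt_one (hv i) (hv j))

/-- Entrywise, X⁻ⁿ - Q⁻ⁿ is the sum of the X⁻ᵏ Q^{-(n-1-k)} times X⁻¹ - Q⁻¹, and X⁻¹ - Q⁻¹ = (Q - X)
X⁻¹ Q⁻¹. Every factor is positive semidefinite, hence so are the Schur products. -/
theorem posSemidef_inv_pow_sub_inv_pow {X Q : Matrix ι ι ℂ} (hX0 : ∀ i j, X i j ≠ 0)
    (hQ0 : ∀ i j, Q i j ≠ 0) (hX : (Matrix.of fun i j => (X i j)⁻¹).PosSemidef)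
    (hQ : (Matrix.of fun i j => (Q i j)⁻¹).PosSemidef) (hQX : (Q - X).PosSemidef) (n : ℕ) :
    (Matrix.of fun i j => (X i j)⁻¹ ^ n - (Q i j)⁻¹ ^ n).PosSemidef := by
  have h1 := posSemidef_sum (Finset.range n) fun k _ =>
    (posSemidef_hadamardPow hX k).hadamard (posSemidef_hadamardPow hQ (n - 1 - k))
  have h2 := h1.hadamard ((hQX.hadamard hX).hadamard hQ)
  refine Eq.subst (motive := fun A : Matrix ι ι ℂ => A.PosSemidef) ?_ h2
  ext i j
  simp only [of_apply, hadamard_apply, Matrix.sum_apply, Matrix.sub_apply]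
  rw [← geom_sum₂_mul]
  congr 1
  have := hX0 i j
  have := hQ0 i j
  field_simp

/-- The quadratic form of the difference at c is C²‖Σ cᵢuᵢ‖² - ‖Σ cᵢvᵢ‖². The inequality makes uᵢ ↦
vᵢ a well-defined bounded map on the span. -/
theorem norm_linearCombination_le_of_posSemidef {u : ι → E} {v : ι → F} {C : ℝ} (hC : 0 ≤ C)
    (h : (((C ^ 2 : ℝ) : ℂ) • gram ℂ u - gram ℂ v).PosSemidef) (c : ι →₀ ℂ) :
    ‖Finsupp.linearCombination ℂ v c‖ ≤ C * ‖Finsupp.linearCombination ℂ u c‖ := by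
  have h1 := h.2 c
  have h2 : (c.sum fun i ci => c.sum fun j cj =>
      star ci * (((C ^ 2 : ℝ) : ℂ) • gram ℂ u - gram ℂ v) i j * cj) =
      ((C ^ 2 * ‖Finsupp.linearCombination ℂ u c‖ ^ 2 -
        ‖Finsupp.linearCombination ℂ v c‖ ^ 2 : ℝ) : ℂ) := by
    push_cast [← sum_star_mul_gram_mul]
    have h3 := sum_star_mul_gram_mul u c
    have h4 := sum_star_mul_gram_mul v c
    push_cast at h3 h4
    rw [← h3, ← h4]
    simp only [Finsupp.sum, Finset.mul_sum, ← Finset.sum_sub_distrib]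
    refine Finset.sum_congr rfl fun i _ => Finset.sum_congr rfl fun j _ => ?_
    simp only [Matrix.sub_apply, Matrix.smul_apply, smul_eq_mul]
    ring
  rw [h2] at h1
  have h5 : 0 ≤ C ^ 2 * ‖Finsupp.linearCombination ℂ u c‖ ^ 2 -
      ‖Finsupp.linearCombination ℂ v c‖ ^ 2 := Complex.zero_le_real.1 h1
  refine (pow_le_pow_iff_left₀ (norm_nonneg _) (by positivity) two_ne_zero).1 ?_
  rw [mul_pow]
  linarith

end PosSemidef

/-- The adjoint is built first: its prescribed values on the kernels extend continuously from their
dense span, and the adjoint of the extension is the weighted composition operator by the reproducing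
property. -/
theorem exists_isWeightedComposition_of_posSemidef {ψ : CSpace N → ℂ} {φ : CSpace N → CSpace N}
    (hφ : Set.MapsTo φ (ball 0 1) (ball 0 1)) {C : ℝ} (hC : 0 ≤ C)
    (h : (((C ^ 2 : ℝ) : ℂ) • Matrix.gram ℂ (szego (N := N)) - Matrix.gram ℂ
      fun w : ball (0 : CSpace N) 1 => conj (ψ w) • szego ⟨φ w, hφ w.2⟩).PosSemidef) :
    ∃ W : HardySpace N →L[ℂ] HardySpace N, IsWeightedComposition ψ φ W := by
  set v : ball (0 : CSpace N) 1 → HardySpace N := fun w => conj (ψ w) • szego ⟨φ w, hφ w.2⟩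
  set T : HardySpace N →L[ℂ] HardySpace N := (Finsupp.linearCombination ℂ v).extendOfNorm
    (Finsupp.linearCombination ℂ (szego (N := N)))
  have hT : ∀ w, T (szego w) = v w := by
    intro w
    have := LinearMap.extendOfNorm_eq denseRange_linearCombination_szego
      ⟨C, norm_linearCombination_le_of_posSemidef hC h⟩ (Finsupp.single w 1)
    simpa using this
  refine ⟨T.adjoint, fun f z hz => ?_⟩
  rw [← inner_szego ⟨z, hz⟩, ContinuousLinearMap.adjoint_inner_right, hT, inner_smul_left,
    inner_szego, Complex.conj_conj]

end

/-! ### An S-lemma and the expansion of the indefinite form. -/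

section

/-- A homogeneous S-lemma for pairs of quadratic forms on a complex vector space. -/
theorem exists_nonneg_mul_le_of_nonneg {V : Type*} [AddCommGroup V] [Module ℂ V] {h H : V → ℝ}
    (hs : ∀ (k : ℂ) v, h (k • v) = ‖k‖ ^ 2 * h v) (Hs : ∀ (k : ℂ) v, H (k • v) = ‖k‖ ^ 2 * H v)
    (Hp : ∀ v u, H (v + u) + H (v - u) = 2 * H v + 2 * H u)
    (hω : ∀ v u, ∃ ω : ℂ, ‖ω‖ = 1 ∧ h (v + ω • u) = h v + h u ∧ h (v - ω • u) = h v + h u)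
    (hH : ∀ v, 0 ≤ h v → 0 ≤ H v) (hne : ∃ v, h v = 1) : ∃ t : ℝ, 0 ≤ t ∧ ∀ v, t * h v ≤ H v := by
  have hnorm : ∀ x : ℝ, 0 < x → ‖(((√x)⁻¹ : ℝ) : ℂ)‖ ^ 2 = x⁻¹ := by
    intro x hx
    rw [Complex.norm_real, Real.norm_eq_abs, sq_abs, inv_pow, Real.sq_sqrt hx.le]
  -- The phase ω removes the cross term of h, so both v + ωu and v - ωu are null vectors of h. There
  -- H ≥ 0, and the parallelogram law adds the two inequalities up to H v + H u ≥ 0.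
  have hcross : ∀ v u, h v = 1 → h u = -1 → -H u ≤ H v := by
    intro v u hv hu
    obtain ⟨ω, hω1, h1, h2⟩ := hω v u
    have h3 := hH _ (by rw [h1, hv, hu]; norm_num)
    have h4 := hH _ (by rw [h2, hv, hu]; norm_num)
    have h5 := Hp v (ω • u)
    rw [Hs, hω1] at h5
    linarith
  -- The multiplier is the infimum of H on {h = 1}. By the cross inequality it dominates -H on {h =
  -- -1}, and homogeneity covers the remaining vectors.
  set S : Set ℝ := H '' {v | h v = 1}
  have hS : S.Nonempty := Set.Nonempty.image _ hne
  have hSb : ∀ x ∈ S, 0 ≤ x := by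
    rintro _ ⟨v, hv, rfl⟩
    exact hH v (by rw [show h v = 1 from hv]; exact zero_le_one)
  refine ⟨sInf S, Real.sInf_nonneg hSb, fun v => ?_⟩
  rcases lt_trichotomy (h v) 0 with hv | hv | hv
  · have hv' : 0 < -h v := by linarith
    set u := (((√(-h v))⁻¹ : ℝ) : ℂ) • v
    have hu : h u = -1 := by rw [hs, hnorm _ hv', inv_mul_eq_div, div_neg, div_self hv.ne]
    have h1 : -H u ≤ sInf S := by
      refine le_csInf hS ?_
      rintro _ ⟨w, hw, rfl⟩
      exact hcross w u hw hu
    rw [Hs, hnorm _ hv', inv_mul_eq_div, ← neg_div, div_le_iff₀ hv'] at h1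
    linarith
  · rw [hv, mul_zero]
    exact hH v hv.ge
  · have h1 : sInf S ≤ H ((((√(h v))⁻¹ : ℝ) : ℂ) • v) := by
      refine csInf_le ⟨0, hSb⟩ ⟨_, ?_, rfl⟩
      change h _ = 1
      rw [hs, hnorm _ hv, inv_mul_cancel₀ hv.ne']
    rwa [Hs, hnorm _ hv, inv_mul_eq_div, le_div_iff₀ hv] at h1

theorem exists_norm_eq_one_re_mul_eq_zero (b : ℂ) : ∃ ω : ℂ, ‖ω‖ = 1 ∧ (ω * b).re = 0 := by
  rcases eq_or_ne b 0 with rfl | hb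
  · exact ⟨1, by simp⟩
  · have hb' : (‖b‖ : ℂ) ≠ 0 := by simpa using hb
    refine ⟨Complex.I * conj b / ‖b‖, by simp [hb], ?_⟩
    have : Complex.I * conj b / ‖b‖ * b = Complex.I * ‖b‖ := by
      field_simp
      rw [Complex.conj_mul']
    rw [this]
    simp

variable {E F : Type*} [NormedAddCommGroup E] [InnerProductSpace ℂ E]
  [NormedAddCommGroup F] [InnerProductSpace ℂ F]

/-- A linear fractional self-map of the ball expands the indefinite form `|c|² - ‖z‖²`. -/
theorem exists_pos_mul_le_of_mapsTo {L : E →ₗ[ℂ] ℂ} {T : E →ₗ[ℂ] F} {a : F} {β : ℝ} (hβ0 : 0 ≤ β)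
    (hβ : β < 1) (hL : ∀ z, ‖L z‖ ≤ β * ‖z‖) (h : ∀ z, ‖z‖ < 1 → ‖a - T z‖ < ‖1 - L z‖) :
    ∃ t : ℝ, 0 < t ∧ ∀ (c : ℂ) (z : E),
      t * (‖c‖ ^ 2 - ‖z‖ ^ 2) ≤ ‖c - L z‖ ^ 2 - ‖c • a - T z‖ ^ 2 := by
  have hpos : ∀ (c : ℂ) (z : E), ‖z‖ < ‖c‖ → ‖c • a - T z‖ < ‖c - L z‖ := by
    intro c z hz
    have hc : c ≠ 0 := norm_pos_iff.1 ((norm_nonneg z).trans_lt hz)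
    have h1 := h (c⁻¹ • z) (by
      rw [norm_smul, norm_inv, inv_mul_eq_div, div_lt_one (norm_pos_iff.2 hc)]; exact hz)
    have h2 : c • a - T z = c • (a - T (c⁻¹ • z)) := by
      rw [map_smul, smul_sub, smul_smul, mul_inv_cancel₀ hc, one_smul]
    have h3 : c - L z = c * (1 - L (c⁻¹ • z)) := by
      rw [map_smul, smul_eq_mul]; field_simp
    rw [h2, h3, norm_smul, norm_mul]
    exact mul_lt_mul_of_pos_left h1 (norm_pos_iff.2 hc)
  -- The closed cone is reached from the open one by shrinking z to sz and letting s → 1.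
  have hnonneg : ∀ (c : ℂ) (z : E), ‖z‖ ≤ ‖c‖ → ‖c • a - T z‖ ≤ ‖c - L z‖ := by
    intro c z hz
    rcases eq_or_ne c 0 with rfl | hc
    · have : z = 0 := by simpa using hz
      simp [this]
    have h1 : Tendsto (fun s : ℝ => ‖c • a - (s : ℂ) • T z‖) (𝓝[<] 1) (𝓝 ‖c • a - T z‖) := by
      have : Continuous fun s : ℝ => ‖c • a - (s : ℂ) • T z‖ := by fun_prop
      simpa using (this.tendsto 1).mono_left nhdsWithin_le_nhds
    have h2 : Tendsto (fun s : ℝ => ‖c - (s : ℂ) • L z‖) (𝓝[<] 1) (𝓝 ‖c - L z‖) := by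
      have : Continuous fun s : ℝ => ‖c - (s : ℂ) • L z‖ := by fun_prop
      simpa using (this.tendsto 1).mono_left nhdsWithin_le_nhds
    refine le_of_tendsto_of_tendsto h1 h2 ?_
    filter_upwards [HardySpace.eventually_mem] with s hs
    have h3 := hpos c ((s : ℂ) • z) (by
      rw [norm_smul, Complex.norm_real, Real.norm_of_nonneg hs.1.le]
      have := norm_pos_iff.2 hc
      nlinarith [hs.1, hs.2, norm_nonneg z])
    rw [map_smul, map_smul] at h3
    exact h3.le
  obtain ⟨t, ht0, ht⟩ := exists_nonneg_mul_le_of_nonneg (V := ℂ × E)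
    (h := fun v => ‖v.1‖ ^ 2 - ‖v.2‖ ^ 2)
    (H := fun v => ‖v.1 - L v.2‖ ^ 2 - ‖v.1 • a - T v.2‖ ^ 2)
    (fun k v => by simp [norm_smul, mul_pow]; ring)
    (fun k v => by
      have h1 : k • v.1 - L (k • v.2) = k * (v.1 - L v.2) := by
        rw [map_smul, smul_eq_mul, smul_eq_mul]; ring
      have h2 : (k • v.1) • a - T (k • v.2) = k • (v.1 • a - T v.2) := by
        rw [map_smul, smul_eq_mul, mul_smul, smul_sub]
      simp only [Prod.smul_fst, Prod.smul_snd, h1, h2, norm_smul, norm_mul]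
      ring)
    (fun v u => by
      have h1 := parallelogram_law_with_norm ℂ (v.1 - L v.2) (u.1 - L u.2)
      have h2 := parallelogram_law_with_norm ℂ (v.1 • a - T v.2) (u.1 • a - T u.2)
      have e1 : (v + u).1 - L (v + u).2 = v.1 - L v.2 + (u.1 - L u.2) := by
        simp only [Prod.fst_add, Prod.snd_add, map_add]; ring
      have e2 : (v - u).1 - L (v - u).2 = v.1 - L v.2 - (u.1 - L u.2) := by
        simp only [Prod.fst_sub, Prod.snd_sub, map_sub]; ring
      have e3 : (v + u).1 • a - T (v + u).2 = v.1 • a - T v.2 + (u.1 • a - T u.2) := by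
        simp only [Prod.fst_add, Prod.snd_add, map_add]; module
      have e4 : (v - u).1 • a - T (v - u).2 = v.1 • a - T v.2 - (u.1 • a - T u.2) := by
        simp only [Prod.fst_sub, Prod.snd_sub, map_sub]; module
      rw [e1, e2, e3, e4]
      linarith)
    (fun v u => by
      obtain ⟨ω, hω, hb⟩ := exists_norm_eq_one_re_mul_eq_zero
        (inner ℂ v.1 u.1 - inner ℂ v.2 u.2)
      refine ⟨ω, hω, ?_⟩
      have h1 := norm_add_sq (𝕜 := ℂ) v.1 (ω • u.1)
      have h2 := norm_add_sq (𝕜 := ℂ) v.2 (ω • u.2)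
      have h3 := norm_sub_sq (𝕜 := ℂ) v.1 (ω • u.1)
      have h4 := norm_sub_sq (𝕜 := ℂ) v.2 (ω • u.2)
      simp only [inner_smul_right, norm_smul, hω, one_mul, RCLike.re_eq_complex_re] at h1 h2 h3 h4
      rw [mul_sub, Complex.sub_re] at hb
      simp only [Prod.fst_add, Prod.snd_add, Prod.fst_sub, Prod.snd_sub, Prod.smul_fst,
        Prod.smul_snd]
      rw [smul_eq_mul] at h1 h3 ⊢
      constructor <;> linarith)
    (fun v hv => by
      have h1 : ‖v.2‖ ≤ ‖v.1‖ :=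
        (pow_le_pow_iff_left₀ (norm_nonneg _) (norm_nonneg _) two_ne_zero).1 (by linarith)
      have := pow_le_pow_left₀ (norm_nonneg _) (hnonneg _ _ h1) 2
      linarith)
    ⟨(1, 0), by simp⟩
  rcases ht0.eq_or_lt with rfl | ht0
  -- Degenerate multiplier t = 0: the form is then nonnegative everywhere, and taking c = Lz forces
  -- Tz = (Lz)a, so the fractional map is the constant a. A positive multiplier is found directly
  -- from β < 1 and ‖a‖ < 1.
  · have ha : ‖a‖ < 1 := by simpa using h 0 (by simp)
    have hT : ∀ z, T z = L z • a := by
      intro z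
      have h1 := ht (L z, z)
      simp only [sub_self, norm_zero, zero_mul] at h1
      have h2 : ‖L z • a - T z‖ = 0 := by
        have := sq_nonneg ‖L z • a - T z‖
        exact pow_eq_zero_iff two_ne_zero |>.1 (by linarith)
      exact (sub_eq_zero.1 (norm_eq_zero.1 h2)).symm
    have hβ2 : 0 < 1 - β ^ 2 := by nlinarith
    have ha2 : 0 < 1 - ‖a‖ ^ 2 := by nlinarith [norm_nonneg a]
    refine ⟨(1 - β ^ 2) * (1 - ‖a‖ ^ 2), by positivity, fun c z => ?_⟩
    rw [hT, ← sub_smul, norm_smul, mul_pow]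
    have h1 : ‖c‖ ≤ ‖c - L z‖ + β * ‖z‖ := by
      have := norm_add_le (c - L z) (L z)
      rw [sub_add_cancel] at this
      exact this.trans (by gcongr; exact hL z)
    have h2 : ‖c‖ ^ 2 ≤ (‖c - L z‖ + β * ‖z‖) ^ 2 := pow_le_pow_left₀ (norm_nonneg _) h1 2
    have h3 : (1 - β ^ 2) * (‖c‖ ^ 2 - ‖z‖ ^ 2) ≤ ‖c - L z‖ ^ 2 := by
      -- With x = ‖c - Lz‖ and n = ‖z‖, the square supplied is exactly x² - (1 - β²)((x + βn)² -
      -- n²).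
      nlinarith [sq_nonneg (β * ‖c - L z‖ - (1 - β ^ 2) * ‖z‖)]
    nlinarith
  · exact ⟨t, ht0, fun c z => ht (c, z)⟩

end

/-! ### The fractional form: boundedness and the kernel test for normality. -/

section

open scoped ComplexOrder

section SesquiForm

variable {E F : Type*} [NormedAddCommGroup E] [InnerProductSpace ℂ E]
  [NormedAddCommGroup F] [InnerProductSpace ℂ F]

/-- The polarization of `|1 - L z|² - ‖a - T z‖²`. -/
def fracForm (L : E →ₗ[ℂ] ℂ) (T : E →ₗ[ℂ] F) (a : F) (z w : E) : ℂ :=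
  (1 - L z) * conj (1 - L w) - inner ℂ (a - T w) (a - T z)

/-- A zero would contradict Cauchy–Schwarz, since each numerator is strictly shorter than its
denominator. -/
theorem fracForm_ne_zero {L : E →ₗ[ℂ] ℂ} {T : E →ₗ[ℂ] F} {a : F}
    (h : ∀ z, ‖z‖ < 1 → ‖a - T z‖ < ‖1 - L z‖) {z w : E} (hz : ‖z‖ < 1) (hw : ‖w‖ < 1) :
    fracForm L T a z w ≠ 0 := by
  refine sub_ne_zero.2 fun h0 => ?_
  have h1 := norm_inner_le_norm (𝕜 := ℂ) (a - T w) (a - T z)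
  rw [← h0, norm_mul, RCLike.norm_conj, mul_comm] at h1
  exact h1.not_gt (mul_lt_mul'' (h w hw) (h z hz) (norm_nonneg _) (norm_nonneg _))

/-- Along the segment s ↦ (sz, sw) the ratio of the two forms is continuous with values in the
finite set of n-th roots of unity, hence constant. At s = 0 it equals 1, because both forms reduce
to one minus the same squared norm. -/
theorem fracForm_eq_of_pow_eq {F' : Type*} [NormedAddCommGroup F'] [InnerProductSpace ℂ F']
    [FiniteDimensional ℂ E] {L L' : E →ₗ[ℂ] ℂ} {T : E →ₗ[ℂ] F} {T' : E →ₗ[ℂ] F'} {a : F} {a' : F'}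
    (h' : ∀ z, ‖z‖ < 1 → ‖a' - T' z‖ < ‖1 - L' z‖)
    (ha : ‖a‖ = ‖a'‖) {n : ℕ} (hn : n ≠ 0)
    (heq : ∀ z w : E, ‖z‖ < 1 → ‖w‖ < 1 → fracForm L T a z w ^ n = fracForm L' T' a' z w ^ n)
    {z w : E} (hz : ‖z‖ < 1) (hw : ‖w‖ < 1) : fracForm L T a z w = fracForm L' T' a' z w := by
  have hin : ∀ x : E, ‖x‖ < 1 → ∀ s ∈ Set.Icc (0 : ℝ) 1, ‖(s : ℂ) • x‖ < 1 := by
    intro x hx s hs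
    rw [norm_smul, Complex.norm_real, Real.norm_of_nonneg hs.1]
    nlinarith [hs.1, hs.2, norm_nonneg x]
  set ρ : ℝ → ℂ := fun s => fracForm L T a ((s : ℂ) • z) ((s : ℂ) • w) /
    fracForm L' T' a' ((s : ℂ) • z) ((s : ℂ) • w)
  have hρc : ContinuousOn ρ (Set.Icc 0 1) := by
    refine ContinuousOn.div ?_ ?_ fun s hs =>
      fracForm_ne_zero h' (hin z hz s hs) (hin w hw s hs)
    all_goals
      refine Continuous.continuousOn ?_
      simp only [fracForm, map_smul]
      fun_prop
  have hρn : Set.MapsTo ρ (Set.Icc 0 1) {x | x ^ n = 1} := by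
    intro s hs
    change ρ s ^ n = 1
    rw [div_pow, heq _ _ (hin z hz s hs) (hin w hw s hs)]
    exact div_self (pow_ne_zero _ (fracForm_ne_zero h' (hin z hz s hs) (hin w hw s hs)))
  have hfin : {x : ℂ | x ^ n = 1}.Finite :=
    (Polynomial.nthRootsFinset n (1 : ℂ)).finite_toSet.subset fun x hx => by
      simpa [Polynomial.mem_nthRootsFinset (Nat.pos_of_ne_zero hn)] using hx
  have h1 := isPreconnected_Icc.constant_of_mapsTo hfin.isDiscrete hρc hρn
    (Set.right_mem_Icc.2 zero_le_one) (Set.left_mem_Icc.2 zero_le_one)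
  have h0 : ρ 0 = 1 := by
    have h2 := fracForm_ne_zero h' (hin z hz 0 (by simp)) (hin w hw 0 (by simp))
    refine (div_eq_one_iff_eq h2).2 ?_
    simp [fracForm, ha]
  have h2 := h1.trans h0
  simp only [ρ, Complex.ofReal_one, one_smul] at h2
  exact (div_eq_one_iff_eq (fracForm_ne_zero h' hz hw)).1 h2

open Matrix in
-- Summing against coefficients cᵢ homogenizes the form: the quadratic form is the hypothesis
-- evaluated at c₀ = Σ cᵢ and z₀ = Σ cᵢvᵢ.
theorem posSemidef_fracForm_sub {L : E →ₗ[ℂ] ℂ} {T : E →ₗ[ℂ] F} {a : F} {t : ℝ}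
    (h : ∀ (c : ℂ) (z : E), t * (‖c‖ ^ 2 - ‖z‖ ^ 2) ≤ ‖c - L z‖ ^ 2 - ‖c • a - T z‖ ^ 2)
    {ι : Type*} (v : ι → E) :
    ((Matrix.of fun i j => fracForm L T a (v j) (v i)) -
      Matrix.of fun i j => (t : ℂ) * (1 - inner ℂ (v i) (v j))).PosSemidef := by
  have hM : ((Matrix.of fun i j => fracForm L T a (v j) (v i)) -
      Matrix.of fun i j => (t : ℂ) * (1 - inner ℂ (v i) (v j))) =
      gram ℂ (fun i => 1 - L (v i)) - gram ℂ (fun i => a - T (v i)) -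
        ((t : ℂ) • gram ℂ (fun _ => (1 : ℂ)) - (t : ℂ) • gram ℂ v) := by
    ext i j
    simp [fracForm]
    ring
  have ht : IsSelfAdjoint (t : ℂ) := Complex.conj_ofReal t
  rw [hM]
  refine ⟨((isHermitian_gram ℂ _).sub (isHermitian_gram ℂ _)).sub
    ((ht.smul (isHermitian_gram ℂ _)).sub (ht.smul (isHermitian_gram ℂ _))), fun c => ?_⟩
  set c₀ := Finsupp.linearCombination ℂ (fun _ : ι => (1 : ℂ)) c with hc₀
  set z₀ := Finsupp.linearCombination ℂ v c with hz₀
  have h1 : Finsupp.linearCombination ℂ (fun i => 1 - L (v i)) c = c₀ - L z₀ := by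
    simp [hc₀, hz₀, Finsupp.linearCombination_apply, Finsupp.sum, mul_sub]
  have h2 : Finsupp.linearCombination ℂ (fun i => a - T (v i)) c = c₀ • a - T z₀ := by
    simp [hc₀, hz₀, Finsupp.linearCombination_apply, Finsupp.sum, smul_sub, Finset.sum_smul]
  have h3 := sum_star_mul_gram_mul (fun i => 1 - L (v i)) c
  have h4 := sum_star_mul_gram_mul (fun i => a - T (v i)) c
  have h5 := sum_star_mul_gram_mul (fun _ : ι => (1 : ℂ)) c
  have h6 := sum_star_mul_gram_mul v c
  rw [h1] at h3
  rw [h2] at h4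
  rw [← hc₀] at h5
  rw [← hz₀] at h6
  have h7 : (c.sum fun i ci => c.sum fun j cj => star ci *
      (gram ℂ (fun i => 1 - L (v i)) - gram ℂ (fun i => a - T (v i)) -
        ((t : ℂ) • gram ℂ (fun _ => (1 : ℂ)) - (t : ℂ) • gram ℂ v) : Matrix ι ι ℂ) i j * cj) =
      ((‖c₀ - L z₀‖ ^ 2 - ‖c₀ • a - T z₀‖ ^ 2 - t * (‖c₀‖ ^ 2 - ‖z₀‖ ^ 2) : ℝ) : ℂ) := by
    rw [Complex.ofReal_sub, Complex.ofReal_sub, Complex.ofReal_mul, Complex.ofReal_sub,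
      ← h3, ← h4, ← h5, ← h6]
    simp only [Finsupp.sum, Finset.mul_sum, ← Finset.sum_sub_distrib]
    refine Finset.sum_congr rfl fun i _ => Finset.sum_congr rfl fun j _ => ?_
    simp only [Matrix.sub_apply, Matrix.smul_apply, smul_eq_mul]
    ring
  rw [h7]
  exact Complex.zero_le_real.2 (sub_nonneg.2 (h c₀ z₀))

/-- The exponent of the weight matches that of the kernel, so the denominators of the fractional map
cancel. For s = 1 - Lz and t = 1 - Lw this turns the weighted kernel into |a|²/Qⁿ. -/
theorem div_pow_mul_conj_div_pow_mul {n : ℕ} (a : ℂ) {s t : ℂ} (hs : s ≠ 0) (ht : t ≠ 0)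
    (x y : E) :
    a / s ^ n * conj (a / t ^ n) * (1 / (1 - inner ℂ (t⁻¹ • y) (s⁻¹ • x)) ^ n) =
      a * conj a / (s * conj t - inner ℂ y x) ^ n := by
  have ht' : conj t ≠ 0 := (map_ne_zero _).2 ht
  have h : s * conj t - inner ℂ y x = s * conj t * (1 - inner ℂ (t⁻¹ • y) (s⁻¹ • x)) := by
    rw [inner_smul_left, inner_smul_right, map_inv₀]
    field_simp
  rw [h, mul_pow, mul_pow, map_div₀, map_pow, div_mul_div_comm, div_mul_div_comm, mul_one]

end SesquiForm

variable {N : ℕ} [NeZero N]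

theorem exists_isWeightedComposition_frac {L : CSpace N →ₗ[ℂ] ℂ}
    {T : CSpace N →ₗ[ℂ] CSpace N} {a : CSpace N} {β : ℝ} (hβ0 : 0 ≤ β) (hβ : β < 1)
    (hL : ∀ z, ‖L z‖ ≤ β * ‖z‖) (h : ∀ z, ‖z‖ < 1 → ‖a - T z‖ < ‖1 - L z‖) (a₁ : ℂ)
    (hφ : Set.MapsTo (fun z => (1 - L z)⁻¹ • (a - T z)) (ball 0 1) (ball 0 1)) :
    ∃ W : HardySpace N →L[ℂ] HardySpace N,
      IsWeightedComposition (fun z => a₁ / (1 - L z) ^ N) (fun z => (1 - L z)⁻¹ • (a - T z)) W := by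
  obtain ⟨t, ht0, ht⟩ := exists_pos_mul_le_of_mapsTo hβ0 hβ hL h
  have hB : ∀ z : ball (0 : CSpace N) 1, ‖(z : CSpace N)‖ < 1 := fun z => mem_ball_zero_iff.1 z.2
  have hl : ∀ z : ball (0 : CSpace N) 1, 1 - L z ≠ 0 := fun z =>
    norm_pos_iff.1 ((norm_nonneg _).trans_lt (h z (hB z)))
  have htC : (t : ℂ) ≠ 0 := by exact_mod_cast ht0.ne'
  set X : Matrix (ball (0 : CSpace N) 1) (ball (0 : CSpace N) 1) ℂ :=
    Matrix.of fun i j => (t : ℂ) * (1 - inner ℂ (i : CSpace N) (j : CSpace N)) with hX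
  set Q : Matrix (ball (0 : CSpace N) 1) (ball (0 : CSpace N) 1) ℂ :=
    Matrix.of fun i j => fracForm L T a (j : CSpace N) (i : CSpace N) with hQ
  have hX0 : ∀ i j, X i j ≠ 0 := fun i j =>
    mul_ne_zero htC (one_sub_ne_zero_of_norm_lt_one (norm_inner_lt_one (hB i) (hB j)))
  have hQ0 : ∀ i j, Q i j ≠ 0 := fun i j => fracForm_ne_zero h (hB j) (hB i)
  have hXp : (Matrix.of fun i j => (X i j)⁻¹).PosSemidef := by
    have h1 := (posSemidef_inv_one_sub_inner hB).smul
      (Complex.zero_le_real.2 (inv_nonneg.2 ht0.le))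
    refine Eq.subst (motive := fun A => Matrix.PosSemidef A) ?_ h1
    ext i j
    simp [hX, mul_comm]
  -- 1/Q is a rank-one kernel times (1 - ⟨φ(z), φ(w)⟩)⁻¹: the cancellation of denominators with
  -- exponent 1.
  have hQp : (Matrix.of fun i j => (Q i j)⁻¹).PosSemidef := by
    have h1 := (posSemidef_gram_of_any fun i : ball (0 : CSpace N) 1 => (1 - L i)⁻¹).hadamard
      (posSemidef_inv_one_sub_inner (v := fun i : ball (0 : CSpace N) 1 =>
        (1 - L i)⁻¹ • (a - T i)) fun i => mem_ball_zero_iff.1 (hφ i.2))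
    refine Eq.subst (motive := fun A => Matrix.PosSemidef A) ?_ h1
    ext i j
    have h2 := div_pow_mul_conj_div_pow_mul (n := 1) 1 (hl j) (hl i) (a - T j) (a - T i)
    simp only [pow_one, one_div, map_one, map_inv₀, mul_one] at h2
    simp only [hQ, Matrix.hadamard_apply, Matrix.gram_apply, Matrix.of_apply, fracForm, ← h2]
    simp
  have hmain := (posSemidef_inv_pow_sub_inv_pow hX0 hQ0 hXp hQp
    (posSemidef_fracForm_sub ht fun z : ball (0 : CSpace N) 1 => (z : CSpace N)) N).smul
    (Complex.zero_le_real.2 (sq_nonneg ‖a₁‖))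
  refine exists_isWeightedComposition_of_posSemidef hφ (C := ‖a₁‖ / √(t ^ N)) (by positivity) ?_
  -- The transpose is needed because the Gram entry (i, j) of the kernels is k_j evaluated at i,
  -- while X and Q carry the arguments in the other order.
  refine Eq.subst (motive := fun A => Matrix.PosSemidef A) ?_ hmain.transpose
  ext i j
  have h2 := div_pow_mul_conj_div_pow_mul (n := N) a₁ (hl i) (hl j) (a - T i) (a - T j)
  have h3 : ((‖a₁‖ / √(t ^ N)) ^ 2 : ℝ) = ‖a₁‖ ^ 2 / t ^ N := by
    rw [div_pow, Real.sq_sqrt (by positivity)]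
  simp only [Matrix.transpose_apply, Matrix.sub_apply, Matrix.smul_apply, Matrix.gram_apply,
    Matrix.of_apply, smul_eq_mul, inner_smul_left, inner_smul_right, Complex.conj_conj,
    inner_szego, szego_apply _ i.2, h3]
  rw [szego_apply _ (hφ i.2)]
  simp only [hX, hQ, Matrix.of_apply, fracForm]
  have h4 := h2
  rw [Complex.mul_conj'] at h4
  rw [mul_sub, ← mul_assoc (conj (a₁ / (1 - L j) ^ N)),
    mul_comm (conj (a₁ / (1 - L j) ^ N)) (a₁ / (1 - L i) ^ N), h4]
  push_cast
  congr 1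
  · rw [inv_pow, mul_pow]
    field_simp
  · rw [inv_pow]
    rfl

theorem IsWeightedComposition.adjoint_szego {ψ : CSpace N → ℂ} {φ : CSpace N → CSpace N}
    {W : HardySpace N →L[ℂ] HardySpace N} (hW : IsWeightedComposition ψ φ W)
    (hφ : Set.MapsTo φ (ball 0 1) (ball 0 1)) (w : ball (0 : CSpace N) 1) :
    W.adjoint (szego w) = conj (ψ w) • szego ⟨φ w, hφ w.2⟩ := by
  refine ext_inner_right ℂ fun f => ?_
  rw [ContinuousLinearMap.adjoint_inner_left, inner_szego, hW f w w.2, inner_smul_left,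
    inner_szego, Complex.conj_conj]

/-- By density and the reproducing property, W*W = WW* may be tested on k_w evaluated at z. -/
theorem isStarNormal_iff_szego {W : HardySpace N →L[ℂ] HardySpace N} :
    IsStarNormal W ↔ ∀ w z : ball (0 : CSpace N) 1,
      inner ℂ (W (szego z)) (W (szego w)) = W (W.adjoint (szego w)) z := by
  rw [isStarNormal_iff, Commute, SemiconjBy]
  constructor
  · intro h w z
    have h1 := congrArg (fun S : HardySpace N →L[ℂ] HardySpace N => S (szego w) z) h
    rw [← ContinuousLinearMap.adjoint_inner_right, inner_szego]
    exact h1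
  · intro h
    refine continuousLinearMap_ext_szego fun w z => ?_
    have h1 := h w z
    rw [← ContinuousLinearMap.adjoint_inner_right, inner_szego] at h1
    exact h1

end

/-! ### Normality as equality of two forms, and its matrix coefficients. -/

section

open Matrix

section Coordinates

variable {N : ℕ}

theorem conjVec_conjVec (a : CSpace N) : conjVec (conjVec a) = a := by
  ext j
  simp [conjVec]

theorem conjVec_sub (a b : CSpace N) : conjVec (a - b) = conjVec a - conjVec b := by
  ext j
  simp [conjVec]

theorem inner_conjVec_conjVec (a b : CSpace N) :
    inner ℂ (conjVec a) (conjVec b) = inner ℂ b a := by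
  simp [conjVec, PiLp.inner_apply, mul_comm]

theorem norm_conjVec (a : CSpace N) : ‖conjVec a‖ = ‖a‖ := by
  simp [conjVec, EuclideanSpace.norm_eq]

theorem conjVec_toEuclideanLin (M : Matrix (Fin N) (Fin N) ℂ) (z : CSpace N) :
    conjVec (Matrix.toEuclideanLin M z) = Matrix.toEuclideanLin (M.map conj) (conjVec z) := by
  ext j
  simp [conjVec, Matrix.toLpLin_apply, Matrix.mulVec, dotProduct]

theorem toEuclideanLin_mul_apply (M M' : Matrix (Fin N) (Fin N) ℂ) (z : CSpace N) :
    Matrix.toEuclideanLin (M * M') z = Matrix.toEuclideanLin M (Matrix.toEuclideanLin M' z) := by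
  simp [Matrix.toLpLin_apply, Matrix.mulVec_mulVec]

theorem inner_toEuclideanLin_conjTranspose (M : Matrix (Fin N) (Fin N) ℂ) (x y : CSpace N) :
    inner ℂ (Matrix.toEuclideanLin Mᴴ x) y = inner ℂ x (Matrix.toEuclideanLin M y) := by
  rw [Matrix.toEuclideanLin_conjTranspose_eq_adjoint, LinearMap.adjoint_inner_left]

theorem inner_toEuclideanLin_of_mul_eq_one {M : Matrix (Fin N) (Fin N) ℂ} (hM : Mᴴ * M = 1)
    (x y : CSpace N) :
    inner ℂ (Matrix.toEuclideanLin M x) (Matrix.toEuclideanLin M y) = inner ℂ x y := by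
  rw [← inner_toEuclideanLin_conjTranspose, ← toEuclideanLin_mul_apply, hM]
  simp

theorem norm_toEuclideanLin_of_mul_eq_one {M : Matrix (Fin N) (Fin N) ℂ} (hM : Mᴴ * M = 1)
    (x : CSpace N) : ‖Matrix.toEuclideanLin M x‖ = ‖x‖ := by
  rw [@norm_eq_sqrt_re_inner ℂ, inner_toEuclideanLin_of_mul_eq_one hM, ← @norm_eq_sqrt_re_inner ℂ]

/-- Separates the constant, linear, conjugate-linear and sesquilinear parts, so that coefficients
can be compared. -/
theorem fracForm_eq_dotProduct {L : CSpace N →ₗ[ℂ] ℂ} {p : Fin N → ℂ}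
    (hL : ∀ z, L z = p ⬝ᵥ z.ofLp) (M : Matrix (Fin N) (Fin N) ℂ) (a z w : CSpace N) :
    fracForm L (Matrix.toEuclideanLin M) a z w = 1 - (‖a‖ : ℂ) ^ 2 -
      (p - star a.ofLp ᵥ* M) ⬝ᵥ z.ofLp - conj ((p - star a.ofLp ᵥ* M) ⬝ᵥ w.ofLp) +
      star w.ofLp ⬝ᵥ (vecMulVec (star p) p - Mᴴ * M) *ᵥ z.ofLp := by
  have h1 : ∀ x y : CSpace N, inner ℂ x (Matrix.toEuclideanLin M y) =
      (star x.ofLp ᵥ* M) ⬝ᵥ y.ofLp := by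
    intro x y
    rw [EuclideanSpace.inner_eq_star_dotProduct, Matrix.toLpLin_apply, dotProduct_comm,
      dotProduct_mulVec]
  have h2 : inner ℂ (Matrix.toEuclideanLin M w) (Matrix.toEuclideanLin M z) =
      star w.ofLp ⬝ᵥ (Mᴴ * M) *ᵥ z.ofLp := by
    rw [h1, Matrix.toLpLin_apply, star_mulVec, vecMul_vecMul, dotProduct_mulVec]
  have h3 : inner ℂ a a = (‖a‖ : ℂ) ^ 2 := inner_self_eq_norm_sq_to_K a
  have h4 : star w.ofLp ⬝ᵥ vecMulVec (star p) p *ᵥ z.ofLp =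
      conj (p ⬝ᵥ w.ofLp) * (p ⬝ᵥ z.ofLp) := by
    rw [vecMulVec_mulVec]
    generalize p ⬝ᵥ z.ofLp = c
    simp only [dotProduct, map_sum, Finset.sum_mul, map_mul]
    refine Finset.sum_congr rfl fun i _ => ?_
    simp
    ring
  rw [fracForm, inner_sub_left, inner_sub_right, inner_sub_right, h1, h2, h3,
    ← inner_conj_symm _ a, h1, sub_mulVec, dotProduct_sub, h4, sub_dotProduct, sub_dotProduct,
    hL, hL]
  simp only [map_sub, map_one]
  ring

theorem fracForm_eq_iff {L L' : CSpace N →ₗ[ℂ] ℂ} {p p' : Fin N → ℂ}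
    (hL : ∀ z, L z = p ⬝ᵥ z.ofLp) (hL' : ∀ z, L' z = p' ⬝ᵥ z.ofLp)
    (M M' : Matrix (Fin N) (Fin N) ℂ) {a a' : CSpace N} (ha : ‖a‖ = ‖a'‖) :
    (∀ z w : CSpace N, ‖z‖ < 1 → ‖w‖ < 1 → fracForm L (Matrix.toEuclideanLin M) a z w =
      fracForm L' (Matrix.toEuclideanLin M') a' z w) ↔
    vecMulVec (star p) p - Mᴴ * M = vecMulVec (star p') p' - M'ᴴ * M' ∧
      p - star a.ofLp ᵥ* M = p' - star a'.ofLp ᵥ* M' := by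
  simp only [fracForm_eq_dotProduct hL, fracForm_eq_dotProduct hL', ha]
  set d := p - star a.ofLp ᵥ* M
  set d' := p' - star a'.ofLp ᵥ* M'
  set E := vecMulVec (star p) p - Mᴴ * M
  set E' := vecMulVec (star p') p' - M'ᴴ * M'
  constructor
  · intro h
    -- Halved basis vectors stay in the open ball. Setting w = 0 isolates the linear part; pairs of
    -- such vectors then give the matrix entries.
    have hn : ∀ j : Fin N, ‖EuclideanSpace.single j (1 / 2 : ℂ)‖ < 1 := by
      intro j
      rw [PiLp.norm_single]
      norm_num
    have hd : d = d' := by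
      ext j
      have := h (EuclideanSpace.single j (1 / 2)) 0 (hn j) (by simp)
      simp at this
      exact this
    refine ⟨?_, hd⟩
    ext i j
    have := h (EuclideanSpace.single j (1 / 2)) (EuclideanSpace.single i (1 / 2)) (hn j) (hn i)
    rw [hd] at this
    simpa using this
  · rintro ⟨h1, h2⟩ z w - -
    rw [h1, h2]

end Coordinates

variable {N : ℕ} [NeZero N]

/-- The duality hypothesis rewrites (1 - Lz)(1 - ⟨φ(z), w⟩) as a function of z of kernel type, so W
k_w is a multiple of the kernel at V(a' - T'w)/(1 - ⟨w, a⟩). The isometry V drops out of the inner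
products, and WW* and W*W become |a₁|² over N-th powers of the two forms. -/
theorem isStarNormal_iff_fracForm {L : CSpace N →ₗ[ℂ] ℂ} {T : CSpace N →ₗ[ℂ] CSpace N}
    {a : CSpace N} (h : ∀ z, ‖z‖ < 1 → ‖a - T z‖ < ‖1 - L z‖) {a₁ : ℂ} (ha₁ : a₁ ≠ 0)
    (hφ : Set.MapsTo (fun z => (1 - L z)⁻¹ • (a - T z)) (ball 0 1) (ball 0 1))
    {W : HardySpace N →L[ℂ] HardySpace N}
    (hW : IsWeightedComposition (fun z => a₁ / (1 - L z) ^ N)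
      (fun z => (1 - L z)⁻¹ • (a - T z)) W)
    {V T' : CSpace N →ₗ[ℂ] CSpace N} {a' : CSpace N} (hV : ∀ x y, inner ℂ (V x) (V y) = inner ℂ x y)
    (hdual : ∀ w z, inner ℂ (V (a' - T' w)) z = L z - inner ℂ w (T z))
    (h' : ∀ z, ‖z‖ < 1 → ‖a' - T' z‖ < ‖1 - innerSL ℂ a z‖) (ha : ‖a‖ = ‖a'‖) :
    IsStarNormal W ↔ ∀ z w : CSpace N, ‖z‖ < 1 → ‖w‖ < 1 →
      fracForm L T a z w = fracForm (innerSL ℂ a).toLinearMap T' a' z w := by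
  have hB : ∀ z : ball (0 : CSpace N) 1, ‖(z : CSpace N)‖ < 1 := fun z => mem_ball_zero_iff.1 z.2
  have hl : ∀ z : ball (0 : CSpace N) 1, 1 - L z ≠ 0 := fun z =>
    norm_pos_iff.1 ((norm_nonneg _).trans_lt (h z (hB z)))
  have hl' : ∀ z : ball (0 : CSpace N) 1, 1 - innerSL ℂ a (z : CSpace N) ≠ 0 := fun z =>
    norm_pos_iff.1 ((norm_nonneg _).trans_lt (h' z (hB z)))
  have hVn : ∀ x, ‖V x‖ = ‖x‖ := fun x => by
    rw [@norm_eq_sqrt_re_inner ℂ, hV, ← @norm_eq_sqrt_re_inner ℂ]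
  have hσ : ∀ w : ball (0 : CSpace N) 1,
      (1 - innerSL ℂ a (w : CSpace N))⁻¹ • V (a' - T' w) ∈ ball (0 : CSpace N) 1 := by
    intro w
    rw [mem_ball_zero_iff, norm_smul, hVn, norm_inv, inv_mul_eq_div,
      div_lt_one (norm_pos_iff.2 (hl' w))]
    exact h' w (hB w)
  have hWs : ∀ w : ball (0 : CSpace N) 1, W (szego w) =
      conj (conj a₁ / (1 - innerSL ℂ a (w : CSpace N)) ^ N) • szego ⟨_, hσ w⟩ := by
    intro w
    refine HardySpace.ext_ball fun z => ?_
    rw [hW _ _ z.2, HardySpace.coe_smul, Pi.smul_apply, szego_apply _ (hφ z.2),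
      szego_apply _ z.2, smul_eq_mul]
    have h1 : conj (1 - innerSL ℂ a (w : CSpace N)) ≠ 0 := (map_ne_zero _).2 (hl' w)
    have h2 : (1 - L z) * (1 - inner ℂ (w : CSpace N) ((1 - L z)⁻¹ • (a - T z))) =
        conj (1 - innerSL ℂ a (w : CSpace N)) *
          (1 - inner ℂ ((1 - innerSL ℂ a (w : CSpace N))⁻¹ • V (a' - T' w)) (z : CSpace N)) := by
      have h3 := hl z
      rw [inner_smul_left, inner_smul_right, hdual, map_inv₀, mul_sub, mul_sub, ← mul_assoc,
        ← mul_assoc, mul_inv_cancel₀ h3, mul_inv_cancel₀ h1, inner_sub_right]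
      simp
      ring
    rw [map_div₀, map_pow, Complex.conj_conj, div_mul_div_comm, div_mul_div_comm, ← mul_pow,
      ← mul_pow, h2]
  have hk1 : ∀ w z : ball (0 : CSpace N) 1, W (W.adjoint (szego w)) z =
      a₁ * conj a₁ / fracForm L T a z w ^ N := by
    intro w z
    rw [hW.adjoint_szego hφ, map_smul, HardySpace.coe_smul, Pi.smul_apply, hW _ _ z.2,
      szego_apply _ (hφ z.2), smul_eq_mul, fracForm,
      ← div_pow_mul_conj_div_pow_mul a₁ (hl z) (hl w)]
    ring
  have hk2 : ∀ w z : ball (0 : CSpace N) 1, inner ℂ (W (szego z)) (W (szego w)) =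
      a₁ * conj a₁ / fracForm (innerSL ℂ a).toLinearMap T' a' z w ^ N := by
    intro w z
    have h1 := div_pow_mul_conj_div_pow_mul (n := N) (conj a₁) (hl' z) (hl' w)
      (V (a' - T' z)) (V (a' - T' w))
    rw [hV, Complex.conj_conj, mul_comm (conj a₁)] at h1
    rw [hWs, hWs, inner_smul_left, inner_smul_right, inner_szego, szego_apply _ (hσ z),
      Complex.conj_conj, ← mul_assoc, h1]
    rfl
  have hc : a₁ * conj a₁ ≠ 0 := mul_ne_zero ha₁ ((map_ne_zero _).2 ha₁)
  rw [isStarNormal_iff_szego]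
  constructor
  · intro hn z w hz hw
    refine fracForm_eq_of_pow_eq h' ha (NeZero.ne N) (fun z w hz hw => ?_) hz hw
    have h1 := hn ⟨w, mem_ball_zero_iff.2 hw⟩ ⟨z, mem_ball_zero_iff.2 hz⟩
    rw [hk1, hk2] at h1
    have h2 := pow_ne_zero N (fracForm_ne_zero h hz hw)
    have h3 := pow_ne_zero N (fracForm_ne_zero (L := (innerSL ℂ a).toLinearMap) h' hz hw)
    exact mul_left_cancel₀ hc ((div_eq_div_iff h3 h2).1 h1)
  · intro heq w z
    rw [hk1, hk2, heq z w (hB z) (hB w)]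

end

end HardyBall

end

/-! ### Specialization to the symmetric matrices A and U. -/

open HardyBall
theorem mainTheorem7 {N : ℕ} [NeZero N] (a₁ : ℂ) (ha₁ : a₁ ≠ 0)
    (a₀ : CSpace N) (ha₀ : a₀ ∈ ball (0 : CSpace N) 1)
    (A U : Matrix (Fin N) (Fin N) ℂ) (hA : A.IsSymm)
    (hU : U ∈ Matrix.unitaryGroup (Fin N) ℂ) (hUs : U.IsSymm)
    (hφ : Set.MapsTo (symbol a₀ A U) (ball 0 1) (ball 0 1)) :
    ∃ W : HardySpace N →L[ℂ] HardySpace N,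
      IsWeightedComposition (weight a₁ a₀ U) (symbol a₀ A U) W ∧
      (IsStarNormal W ↔
        (U * A).map conj * A * U
            - Matrix.vecMulVec (star (U.mulVec a₀)) a₀ * U
          = A * A.map conj - Matrix.vecMulVec a₀ (star a₀.ofLp) ∧
        ((U * A).map conj).mulVec a₀ - star (U.mulVec a₀)
          = A.mulVec (star a₀.ofLp) - a₀.ofLp) := by
  have ha : ‖a₀‖ < 1 := mem_ball_zero_iff.1 ha₀
  have hU1 : U.conjTranspose * U = 1 := Matrix.mem_unitaryGroup_iff'.1 hU
  have hU2 : U.conjTranspose.conjTranspose * U.conjTranspose = 1 := by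
    rw [Matrix.conjTranspose_conjTranspose]
    exact Matrix.mem_unitaryGroup_iff.1 hU
  have hU3 : U * U.conjTranspose = 1 := Matrix.mem_unitaryGroup_iff.1 hU
  have hAc : A.conjTranspose = A.map conj := by
    rw [Matrix.conjTranspose, hA.eq]
    rfl
  have hUc : U.conjTranspose = U.map conj := by
    rw [Matrix.conjTranspose, hUs.eq]
    rfl
  set L : CSpace N →ₗ[ℂ] ℂ :=
    (innerSL ℂ (conjVec a₀)).toLinearMap ∘ₗ Matrix.toEuclideanLin U
  have hL : ∀ z, ‖L z‖ ≤ ‖a₀‖ * ‖z‖ := by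
    intro z
    have h1 := norm_inner_le_norm (𝕜 := ℂ) (conjVec a₀) (Matrix.toEuclideanLin U z)
    rwa [norm_conjVec, norm_toEuclideanLin_of_mul_eq_one hU1] at h1
  have hL0 : ∀ z, ‖z‖ < 1 → 1 - L z ≠ 0 := fun z hz => one_sub_ne_zero_of_norm_lt_one
    ((hL z).trans_lt (by nlinarith [norm_nonneg a₀, norm_nonneg z]))
  have h : ∀ z, ‖z‖ < 1 → ‖a₀ - Matrix.toEuclideanLin (A * U) z‖ < ‖1 - L z‖ := by
    intro z hz
    have h1 : ‖(1 - L z)⁻¹ • (a₀ - Matrix.toEuclideanLin (A * U) z)‖ < 1 :=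
      mem_ball_zero_iff.1 (hφ (mem_ball_zero_iff.2 hz))
    rwa [norm_smul, norm_inv, inv_mul_eq_div, div_lt_one (norm_pos_iff.2 (hL0 z hz))] at h1
  -- The dual estimate is the estimate for φ at U* conj(z), conjugated. Symmetry of A enters here:
  -- the conjugation produces conj A, which must be A*.
  have h' : ∀ z, ‖z‖ < 1 →
      ‖conjVec a₀ - Matrix.toEuclideanLin A.conjTranspose z‖ < ‖1 - innerSL ℂ a₀ z‖ := by
    intro z hz
    have hUz : Matrix.toEuclideanLin U (Matrix.toEuclideanLin U.conjTranspose (conjVec z)) =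
        conjVec z := by
      rw [← toEuclideanLin_mul_apply, hU3]
      simp
    have h1 := h (Matrix.toEuclideanLin U.conjTranspose (conjVec z))
      (by rwa [norm_toEuclideanLin_of_mul_eq_one hU2, norm_conjVec])
    have h2 : L (Matrix.toEuclideanLin U.conjTranspose (conjVec z)) = conj (inner ℂ a₀ z) := by
      change inner ℂ (conjVec a₀) (Matrix.toEuclideanLin U _) = _
      rw [hUz, inner_conjVec_conjVec, inner_conj_symm]
    rw [toEuclideanLin_mul_apply, hUz, h2, ← norm_conjVec, conjVec_sub, conjVec_toEuclideanLin,
      conjVec_conjVec, ← hAc, ← map_one (starRingEnd ℂ), ← map_sub, RCLike.norm_conj] at h1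
    simpa using h1
  obtain ⟨W, hW⟩ := exists_isWeightedComposition_frac (norm_nonneg a₀) ha hL h a₁ hφ
  refine ⟨W, hW, ?_⟩
  rw [isStarNormal_iff_fracForm h ha₁ hφ hW (V := Matrix.toEuclideanLin U.conjTranspose)
    (inner_toEuclideanLin_of_mul_eq_one hU2) (T' := Matrix.toEuclideanLin A.conjTranspose)
    (a' := conjVec a₀) ?_ h' (norm_conjVec a₀).symm,
    fracForm_eq_iff (p := Matrix.vecMul a₀ U) (p' := star a₀.ofLp) ?_ ?_ _ _
      (norm_conjVec a₀).symm]
  · have hp : Matrix.vecMul a₀ U = U.mulVec a₀ := by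
      rw [← Matrix.mulVec_transpose, hUs.eq]
    -- Symmetry of both matrices turns conj(UA) into (AU)*, the adjoint of the linear part of φ.
    have hB : (U * A).map conj = (A * U).conjTranspose := by
      rw [Matrix.conjTranspose_mul, hAc, hUc, Matrix.map_mul]
    have hcc : star (conjVec a₀).ofLp = a₀.ofLp := by
      ext j
      simp [conjVec]
    rw [hB, Matrix.vecMulVec_mul, ← hAc, Matrix.mul_assoc, ← hp, Matrix.conjTranspose_conjTranspose,
      star_star, hcc]
    -- The coefficient identities are the stated ones up to sign; the linear one is also conjugated,
    -- since it was read off as a row vector.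
    refine and_congr ?_ ?_
    · rw [← neg_inj, neg_sub, neg_sub]
    · rw [← star_inj, ← neg_inj, star_sub, star_sub, neg_sub, neg_sub, Matrix.star_vecMul,
        Matrix.star_vecMul, Matrix.star_vecMul, star_star, Matrix.conjTranspose_conjTranspose]
  · intro z
    change inner ℂ (conjVec a₀) (Matrix.toEuclideanLin U z) = _
    rw [EuclideanSpace.inner_eq_star_dotProduct, Matrix.toLpLin_apply, dotProduct_comm,
      ← Matrix.dotProduct_mulVec]
    congr 1
    ext j
    simp [conjVec]
  · intro z
    change inner ℂ a₀ z = _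
    rw [EuclideanSpace.inner_eq_star_dotProduct, dotProduct_comm]
  · intro w z
    rw [inner_toEuclideanLin_conjTranspose, inner_sub_left, inner_toEuclideanLin_conjTranspose,
      toEuclideanLin_mul_apply]
    rfl
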